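/- Let $n,m\ge 1$ be integers, $0<\alpha<\min(n,2m)$, $1\le p<n/\alpha$, and let $f\in L^p(\mathbb R^n)$ be real- or complex-valued. Put $$\gamma_n(\beta)=\frac{2^{\beta}\pi^{n/2}\,\Gamma(\beta/2)}{\Gamma((n-\beta)/2)}\quad(\beta>0),$$ with $1/\Gamma=0$ at the poles of $\Gamma$, and let $$(I^\alpha f)(x)=\frac1{\gamma_n(\alpha)}\int_{\mathbb R^n}\frac{f(y)\,dy}{|x-y|^{n-\alpha}}$$ be the Riesz potential of $f$. Let $$w(x)=(-\Delta)^m\big[(1+|x|^2)^{m-(n+\alpha)/2}\big],\qquad \tilde w=-\Delta w,$$ where $\Delta$ is the Laplacian on $\mathbb R^n$, and write $w_t(x)=t^{-n}w(x/t)$, $\tilde w_t(x)=t^{-n}\tilde w(x/t)$ for $t>0$. Then the integral defining $(I^\alpha f)(x)$ converges absolutely for almost every $x$; for every $x\in\mathbb R^n$, $t>0$ and $\varepsilon>0$ the integrals defining $$A_t(x)=(I^\alpha f * t^{-\alpha}w_t)(x),\qquad (I^\alpha f*\tilde w_t)(x),\qquad J_\varepsilon(x)=\int_\varepsilon^\infty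 (I^\alpha f*\tilde w_t)(x)\,\frac{dt}{t^{1+\alpha}}$$ converge absolutely; $A_t,J_\varepsilon\in L^p(\mathbb R^n)$; and $$\gamma_n(2m-\alpha)\,f=\lim_{t\to0^+}A_t,\qquad (2m-\alpha)\,\gamma_n(2m-\alpha)\,f=\lim_{\varepsilon\to0^+}J_\varepsilon .$$ Both limits hold in the $L^p$-norm and almost everywhere. If, moreover, $f$ is continuous and vanishes at infinity, then both limits also hold in the sup-norm, uniformly on $\mathbb R^n$. -/

import Mathlib

open MeasureTheory Filter Topology Set
open scoped ENNReal

noncomputable section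

namespace RieszInversion

/-- The normalizing constant `γ_n(β) = 2^β π^{n/2} Γ(β/2) / Γ((n-β)/2)`.
At the poles of the denominator (`β = n, n+2, …`) it is `0`, which agrees with reading
`1/Γ` as an entire function, because `Real.Gamma` is `0` at its poles and `x / 0 = 0`. -/
def rieszGamma (n : ℕ) (β : ℝ) : ℝ :=
  2 ^ β * Real.pi ^ ((n : ℝ) / 2) * Real.Gamma (β / 2) / Real.Gamma (((n : ℝ) - β) / 2)

/-- The integrand `y ↦ f(y) / |x - y|^{n-α}` of the Riesz potential at the point `x`. -/
def rieszIntegrand {n : ℕ} {𝕜 : Type*} [RCLike 𝕜] (α : ℝ)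
    (f : EuclideanSpace ℝ (Fin n) → 𝕜) (x y : EuclideanSpace ℝ (Fin n)) : 𝕜 :=
  (‖x - y‖ ^ ((n : ℝ) - α))⁻¹ • f y

/-- The Riesz potential `(I^α f)(x) = γ_n(α)⁻¹ ∫ f(y) / |x - y|^{n-α} dy`. -/
def rieszPotential {n : ℕ} {𝕜 : Type*} [RCLike 𝕜] (α : ℝ)
    (f : EuclideanSpace ℝ (Fin n) → 𝕜) (x : EuclideanSpace ℝ (Fin n)) : 𝕜 :=
  (rieszGamma n α)⁻¹ • ∫ y, rieszIntegrand α f x y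

/-- The operator `-Δ` on real-valued functions. -/
def negLaplacian {n : ℕ} (g : EuclideanSpace ℝ (Fin n) → ℝ) :
    EuclideanSpace ℝ (Fin n) → ℝ :=
  fun x => -(Laplacian.laplacian g x)

/-- The reconstructing function `w(x) = (-Δ)^m [(1+|x|²)^{m-(n+α)/2}]`. -/
def recon (n m : ℕ) (α : ℝ) : EuclideanSpace ℝ (Fin n) → ℝ :=
  negLaplacian^[m] (fun x => (1 + ‖x‖ ^ 2) ^ ((m : ℝ) - ((n : ℝ) + α) / 2))

/-- The reconstructing function `w̃ = -Δ w`. -/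
def reconTilde (n m : ℕ) (α : ℝ) : EuclideanSpace ℝ (Fin n) → ℝ :=
  negLaplacian (recon n m α)

/-- The scaled function `w_t(x) = t^{-n} w(x/t)`. -/
def dilate {n : ℕ} (w : EuclideanSpace ℝ (Fin n) → ℝ) (t : ℝ) :
    EuclideanSpace ℝ (Fin n) → ℝ :=
  fun x => (t ^ n)⁻¹ * w (t⁻¹ • x)

/-- The bilinear map `(z, r) ↦ r • z` used for convolving a `𝕜`-valued function with a
real-valued one. -/
def mulRight (𝕜 : Type*) [RCLike 𝕜] : 𝕜 →L[ℝ] ℝ →L[ℝ] 𝕜 :=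
  (ContinuousLinearMap.lsmul ℝ ℝ : ℝ →L[ℝ] 𝕜 →L[ℝ] 𝕜).flip

/-- The convolution `(g ∗ k)(x) = ∫ g(y) k(x - y) dy` of a `𝕜`-valued with a real-valued
function. -/
def conv {n : ℕ} {𝕜 : Type*} [RCLike 𝕜] (g : EuclideanSpace ℝ (Fin n) → 𝕜)
    (k : EuclideanSpace ℝ (Fin n) → ℝ) : EuclideanSpace ℝ (Fin n) → 𝕜 :=
  MeasureTheory.convolution g k (mulRight 𝕜) volume

/-- The convolution integral `∫ g(y) k(x - y) dy` converges absolutely for every `x`. -/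
def ConvDefined {n : ℕ} {𝕜 : Type*} [RCLike 𝕜] (g : EuclideanSpace ℝ (Fin n) → 𝕜)
    (k : EuclideanSpace ℝ (Fin n) → ℝ) : Prop :=
  MeasureTheory.ConvolutionExists g k (mulRight 𝕜) volume

/-- `I^α f ∗ t^{-α} w_t`. -/
def approxInv {n : ℕ} {𝕜 : Type*} [RCLike 𝕜] (m : ℕ) (α : ℝ)
    (f : EuclideanSpace ℝ (Fin n) → 𝕜) (t : ℝ) : EuclideanSpace ℝ (Fin n) → 𝕜 :=
  conv (rieszPotential α f) (fun y => t ^ (-α) * dilate (recon n m α) t y)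

/-- The integrand `t ↦ (I^α f ∗ w̃_t)(x) / t^{1+α}` of the wavelet-type formula. -/
def waveletIntegrand {n : ℕ} {𝕜 : Type*} [RCLike 𝕜] (m : ℕ) (α : ℝ)
    (f : EuclideanSpace ℝ (Fin n) → 𝕜) (x : EuclideanSpace ℝ (Fin n)) (t : ℝ) : 𝕜 :=
  (t ^ (1 + α))⁻¹ • conv (rieszPotential α f) (dilate (reconTilde n m α) t) x

/-- The truncated integral `∫_ε^∞ (I^α f ∗ w̃_t)(x) t^{-1-α} dt`. -/
def waveletInv {n : ℕ} {𝕜 : Type*} [RCLike 𝕜] (m : ℕ) (α : ℝ)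
    (f : EuclideanSpace ℝ (Fin n) → 𝕜) (ε : ℝ) (x : EuclideanSpace ℝ (Fin n)) : 𝕜 :=
  ∫ t in Ioi ε, waveletIntegrand m α f x t

/-- The family `F t` converges to `g`, as `t → 0+`, in the `L^p`-norm and almost everywhere,
and also in the sup-norm over all points if `f` is continuous and vanishes at infinity. The
members of the family lie in `L^p`. -/
structure ConvergesTo {n : ℕ} {𝕜 : Type*} [RCLike 𝕜] (p : ℝ≥0∞)
    (f : EuclideanSpace ℝ (Fin n) → 𝕜) (F : ℝ → EuclideanSpace ℝ (Fin n) → 𝕜)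
    (g : EuclideanSpace ℝ (Fin n) → 𝕜) : Prop where
  memLp : ∀ t : ℝ, 0 < t → MemLp (F t) p volume
  tendsto_Lp : Tendsto (fun t : ℝ => eLpNorm (F t - g) p volume) (𝓝[>] 0) (𝓝 0)
  tendsto_ae : ∀ᵐ x ∂(volume : Measure (EuclideanSpace ℝ (Fin n))),
    Tendsto (fun t : ℝ => F t x) (𝓝[>] 0) (𝓝 (g x))
  tendsto_sup : Continuous f → Tendsto f (cocompact (EuclideanSpace ℝ (Fin n))) (𝓝 0) →
    TendstoUniformly F g (𝓝[>] 0)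

end RieszInversion

end

/-! Both reconstructing kernels come from differentiation in the scale. Put `A = (n+α)/2` and `q =
|x|²`. The function `(-Δ)^m (1+q)^(m-A)` is a combination of the powers `(1+q)^(-A-j)`, and its
coefficients are, up to one constant, the Leibniz coefficients of `∂_l^m [l^(α/2) (l+q)^(-A)]`.
After dilation, `t^(-α) w_t` is a constant times `S_m`, where `S_i(t)` is `t^(2i-α) ∂_l^i [l^(α/2)
(l+q)^(-A)]` at `l = t²`. One more Laplacian makes `t^(-1-α) w̃_t` a constant times `dS_(m+1)/dt`.
Since `S_(m+1)` vanishes as `t → ∞`, the integral over `(ε, ∞)` is a constant times `S_(m+1)(ε)`.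
Both formulas thus concern `I^α f * S_i`, with `i = m` or `i = m+1`.

The Riesz kernel sends `(l+|y|²)^(-A)` to a constant times `l^(-α/2) (l+|x|²)^(-(n-α)/2)`
(`lintegral_riesz_bracket`). The factor `l^(α/2)` cancels `l^(-α/2)`, so differentiating `i` times
in `l` leaves a multiple of `(l+|x|²)^(-b)` with `b = (n-α)/2 + i` (`integral_riesz_leibnizSum`). By
Fubini, `I^α f * S_i` is a multiple of the convolution of `f` with the dilates of `(1+|x|²)^(-b)`
(`approxInv_eq`, `waveletInv_eq`). For `i = m` the condition `b > n/2` is exactly `α < 2m`, so these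
dilates form an approximate identity. Their mass, a quotient of Gamma values, turns the accumulated
constants into those of the theorem (`approx_const_eq`, `wavelet_const_eq`).

For the convergence, the kernel is written as a superposition of indicators of balls. A single
estimate, `lintegral_bracketKernel_mul_le`, then bounds an integral against the kernel by averages
over small balls plus a tail that vanishes with `t`. It is applied to `|f(z) - f(x)|` at Lebesgue
points, to the same function uniformly in `x`, and to the `L^p` modulus of translation. -/

noncomputable section

namespace RieszInversion

/-! ### Falling factorials and the Gamma function -/

/-- The falling factorial `a (a - 1) ⋯ (a - k + 1)`. -/
def fallingFactorial (a : ℝ) (k : ℕ) : ℝ := ∏ i ∈ Finset.range k, (a - i)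

@[simp] lemma fallingFactorial_zero (a : ℝ) : fallingFactorial a 0 = 1 := by
  simp [fallingFactorial]

lemma fallingFactorial_succ (a : ℝ) (k : ℕ) :
    fallingFactorial a (k + 1) = fallingFactorial a k * (a - k) := by
  simp [fallingFactorial, Finset.prod_range_succ]

lemma fallingFactorial_add_one_succ (a : ℝ) (k : ℕ) :
    fallingFactorial (a + 1) (k + 1) = (a + 1) * fallingFactorial a k := by
  simp only [fallingFactorial, Finset.prod_range_succ', Nat.cast_zero, sub_zero, mul_comm (a + 1)]
  congr 1
  refine Finset.prod_congr rfl fun i _ => ?_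
  push_cast; ring

lemma fallingFactorial_add (a : ℝ) (i j : ℕ) :
    fallingFactorial a (i + j) = fallingFactorial a i * fallingFactorial (a - i) j := by
  simp only [fallingFactorial, Finset.prod_range_add]
  congr 1
  refine Finset.prod_congr rfl fun k _ => ?_
  push_cast; ring

/-- Iterate `Γ(z+1) = z Γ(z)`. The recursion breaks at `z = 0`, which the hypothesis excludes. -/
lemma Gamma_eq_fallingFactorial_mul (a : ℝ) (k : ℕ) (h : ∀ i < k, a + i ≠ 0) :
    Real.Gamma (a + k) = (-1) ^ k * fallingFactorial (-a) k * Real.Gamma a := by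
  induction k with
  | zero => simp
  | succ k ih =>
    rw [fallingFactorial_succ, Nat.cast_succ, ← add_assoc, Real.Gamma_add_one (h k (by simp)),
      ih fun i hi => h i (by omega)]
    ring

/-! ### The Laplacian of powers of `1 + |x|²` -/

section Laplacian

variable {n : ℕ}

lemma one_add_norm_sq_pos {l : ℝ} (hl : 0 < l) (x : EuclideanSpace ℝ (Fin n)) :
    0 < l + ‖x‖ ^ 2 := by positivity

lemma hasFDerivAt_bracket_rpow (τ : ℝ) (x : EuclideanSpace ℝ (Fin n)) :
    HasFDerivAt (fun x : EuclideanSpace ℝ (Fin n) => (1 + ‖x‖ ^ 2) ^ τ)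
      ((2 * τ * (1 + ‖x‖ ^ 2) ^ (τ - 1)) • innerSL ℝ x) x := by
  have h1 : HasFDerivAt (fun x : EuclideanSpace ℝ (Fin n) => 1 + ‖x‖ ^ 2)
      ((2 : ℝ) • innerSL ℝ x) x := by
    have := (hasStrictFDerivAt_norm_sq x).hasFDerivAt.const_add 1
    rwa [← Nat.cast_smul_eq_nsmul ℝ, Nat.cast_ofNat] at this
  have h2 := h1.rpow_const (p := τ) (Or.inl (one_add_norm_sq_pos one_pos x).ne')
  rw [smul_smul] at h2
  rwa [mul_comm 2 τ, mul_right_comm]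

lemma contDiff_bracket_rpow (τ : ℝ) {k : WithTop ℕ∞} :
    ContDiff ℝ k (fun x : EuclideanSpace ℝ (Fin n) => (1 + ‖x‖ ^ 2) ^ τ) :=
  (contDiff_const.add (contDiff_norm_sq ℝ)).rpow_const_of_ne
    fun x => (one_add_norm_sq_pos one_pos x).ne'

/-- The trace of the Hessian contains a factor `|x|²`; replacing it by `(1 + |x|²) - 1` leaves only
two pure powers. -/
lemma negLaplacian_bracket_rpow (τ : ℝ) (x : EuclideanSpace ℝ (Fin n)) :
    negLaplacian (fun x : EuclideanSpace ℝ (Fin n) => (1 + ‖x‖ ^ 2) ^ τ) x =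
      4 * τ * (τ - 1) * (1 + ‖x‖ ^ 2) ^ (τ - 2)
        - 2 * τ * (n + 2 * τ - 2) * (1 + ‖x‖ ^ 2) ^ (τ - 1) := by
  unfold negLaplacian
  have hf : fderiv ℝ (fun x : EuclideanSpace ℝ (Fin n) => (1 + ‖x‖ ^ 2) ^ τ) =
      fun x => (2 * τ * (1 + ‖x‖ ^ 2) ^ (τ - 1)) • innerSL ℝ x :=
    funext fun x => (hasFDerivAt_bracket_rpow τ x).fderiv
  have hd : HasFDerivAt (fun x : EuclideanSpace ℝ (Fin n) =>
      (2 * τ * (1 + ‖x‖ ^ 2) ^ (τ - 1)) • innerSL ℝ x) _ x :=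
    ((hasFDerivAt_bracket_rpow (τ - 1) x).const_mul (2 * τ)).smul (innerSL ℝ).hasFDerivAt
  have key : ∀ v : EuclideanSpace ℝ (Fin n),
      iteratedFDeriv ℝ 2 (fun x : EuclideanSpace ℝ (Fin n) => (1 + ‖x‖ ^ 2) ^ τ) x ![v, v] =
        2 * τ * (1 + ‖x‖ ^ 2) ^ (τ - 1) * ‖v‖ ^ 2 +
          4 * τ * (τ - 1) * (1 + ‖x‖ ^ 2) ^ (τ - 2) * inner ℝ x v ^ 2 := by
    intro v
    rw [iteratedFDeriv_two_apply, hf, hd.fderiv]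
    simp only [add_apply, smul_apply,
      ContinuousLinearMap.smulRight_apply, innerSL_apply_apply, Matrix.cons_val_zero,
      Matrix.cons_val_one, smul_eq_mul]
    have hv : (innerSL ℝ v) v = ‖v‖ ^ 2 := by simp
    rw [hv, show τ - 1 - 1 = τ - 2 by ring]
    ring
  have hx : ∑ i, inner ℝ x (EuclideanSpace.basisFun (Fin n) ℝ i) ^ 2 = ‖x‖ ^ 2 := by
    simpa using (EuclideanSpace.basisFun (Fin n) ℝ).sum_sq_norm_inner_left x
  rw [InnerProductSpace.laplacian_eq_iteratedFDeriv_orthonormalBasis _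
    (EuclideanSpace.basisFun (Fin n) ℝ)]
  simp only [key, Finset.sum_add_distrib, ← Finset.mul_sum, hx,
    OrthonormalBasis.norm_eq_one, one_pow, Finset.sum_const, Finset.card_univ, Fintype.card_fin,
    nsmul_eq_mul, mul_one]
  have hp := one_add_norm_sq_pos one_pos x
  have : (1 + ‖x‖ ^ 2) ^ (τ - 1) = (1 + ‖x‖ ^ 2) ^ (τ - 2) * (1 + ‖x‖ ^ 2) := by
    rw [← Real.rpow_add_one hp.ne']; ring_nf
  rw [this]
  ring

lemma negLaplacian_sum_bracket_rpow (k : ℕ) (b τ : ℕ → ℝ) (x : EuclideanSpace ℝ (Fin n)) :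
    negLaplacian (fun x : EuclideanSpace ℝ (Fin n) =>
        ∑ j ∈ Finset.range k, b j * (1 + ‖x‖ ^ 2) ^ τ j) x =
      ∑ j ∈ Finset.range k, b j * (4 * τ j * (τ j - 1) * (1 + ‖x‖ ^ 2) ^ (τ j - 2)
        - 2 * τ j * (n + 2 * τ j - 2) * (1 + ‖x‖ ^ 2) ^ (τ j - 1)) := by
  induction k with
  | zero => simp [negLaplacian]
  | succ k ih =>
    have h1 : ContDiff ℝ 2 (fun x : EuclideanSpace ℝ (Fin n) =>
        ∑ j ∈ Finset.range k, b j * (1 + ‖x‖ ^ 2) ^ τ j) :=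
      ContDiff.sum fun j _ => contDiff_const.mul (contDiff_bracket_rpow _)
    have h2 : ContDiff ℝ 2 (fun x : EuclideanSpace ℝ (Fin n) => (1 + ‖x‖ ^ 2) ^ τ k) :=
      contDiff_bracket_rpow _
    have h3 : ContDiff ℝ 2 (b k • fun x : EuclideanSpace ℝ (Fin n) => (1 + ‖x‖ ^ 2) ^ τ k) :=
      contDiff_const.smul h2
    have e : (fun x : EuclideanSpace ℝ (Fin n) =>
        ∑ j ∈ Finset.range (k + 1), b j * (1 + ‖x‖ ^ 2) ^ τ j) =
        (fun x : EuclideanSpace ℝ (Fin n) => ∑ j ∈ Finset.range k, b j * (1 + ‖x‖ ^ 2) ^ τ j) +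
          b k • fun x : EuclideanSpace ℝ (Fin n) => (1 + ‖x‖ ^ 2) ^ τ k := by
      ext x; simp [Finset.sum_range_succ]
    have hk := negLaplacian_bracket_rpow (τ k) x
    unfold negLaplacian at ih hk ⊢
    rw [e, h1.contDiffAt.laplacian_add h3.contDiffAt,
      InnerProductSpace.laplacian_smul _ h2.contDiffAt, neg_add, ih, Finset.sum_range_succ,
      smul_eq_mul, ← mul_neg, hk]

end Laplacian

/-! ### Iterated Laplacians -/

/-- The coefficients of `(-Δ)^i (1 + |x|²)^s` in terms of `(1 + |x|²)^(s-i-j)`. -/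
def polyLaplaceCoeff (n : ℕ) (s : ℝ) (i j : ℕ) : ℝ :=
  4 ^ i * i.choose j * fallingFactorial (i - n / 2 - s) (i - j) * fallingFactorial s (i + j)

lemma polyLaplaceCoeff_zero_right (n : ℕ) (s : ℝ) (i : ℕ) :
    polyLaplaceCoeff n s (i + 1) 0 =
      -(2 * (s - i) * (n + 2 * (s - i) - 2)) * polyLaplaceCoeff n s i 0 := by
  simp only [polyLaplaceCoeff, Nat.choose_zero_right, Nat.cast_one, mul_one, Nat.sub_zero,
    Nat.add_zero, fallingFactorial_succ s]
  have := fallingFactorial_add_one_succ (i - n / 2 - s) i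
  rw [show ((i + 1 : ℕ) : ℝ) - n / 2 - s = i - n / 2 - s + 1 by push_cast; ring, this]
  ring

/-- One application of `-Δ` lowers an exponent by one or by two, so index `j + 1` at the next stage
is fed by the old index `j + 1` and the old index `j`. -/
lemma polyLaplaceCoeff_succ_succ (n : ℕ) (s : ℝ) (i j : ℕ) :
    polyLaplaceCoeff n s (i + 1) (j + 1) =
      4 * (s - i - j) * (s - i - j - 1) * polyLaplaceCoeff n s i j
      - 2 * (s - i - (j + 1)) * (n + 2 * (s - i - (j + 1)) - 2) *
        polyLaplaceCoeff n s i (j + 1) := by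
  simp only [polyLaplaceCoeff]
  have e : ((i + 1 : ℕ) : ℝ) - n / 2 - s = i - n / 2 - s + 1 := by push_cast; ring
  rw [e, show i + 1 + (j + 1) = i + j + 1 + 1 by ring, show i + (j + 1) = i + j + 1 by ring,
    Nat.add_sub_add_right]
  simp only [fallingFactorial_succ s]
  push_cast
  rcases lt_trichotomy i j with h | h | h
  · simp [Nat.choose_eq_zero_of_lt h, Nat.choose_eq_zero_of_lt (show i < j + 1 by omega),
      Nat.choose_eq_zero_of_lt (show i + 1 < j + 1 by omega)]
  · subst h
    simp
    ring
  · obtain ⟨k, rfl⟩ := Nat.exists_eq_add_of_lt h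
    rw [show j + k + 1 - (j + 1) = k by omega, show j + k + 1 - j = k + 1 by omega,
      fallingFactorial_add_one_succ, fallingFactorial_succ, Nat.choose_succ_succ]
    -- With falling factorials split to a common length, this relation between neighbouring binomial
    -- coefficients is the only remaining content.
    have hc : ((j + k + 1).choose (j + 1) : ℝ) * (j + 1) = (j + k + 1).choose j * (k + 1) := by
      have := Nat.choose_succ_right_eq (j + k + 1) j
      rw [show j + k + 1 - j = k + 1 by omega] at this
      exact_mod_cast this
    push_cast
    linear_combination (-4 * 4 ^ (j + k + 1) * fallingFactorial (j + k + 1 - n / 2 - s) k *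
      fallingFactorial s (j + k + 1 + j) * (s - (j + k + 1 + j)) * (s - (j + k + 1 + j) - 1)) * hc

/-- Collects equal powers: in each use, `v (j + 1)` carries the same power as `u j`, and the top
coefficient `v k` vanishes. -/
lemma sum_range_add_shift (k : ℕ) (u v : ℕ → ℝ) (hv : v k = 0) :
    ∑ j ∈ Finset.range k, (u j + v j) = ∑ j ∈ Finset.range k, (u j + v (j + 1)) + v 0 := by
  have h := (Finset.sum_range_succ v k).symm.trans (Finset.sum_range_succ' v k)
  rw [hv, add_zero] at h
  rw [Finset.sum_add_distrib, Finset.sum_add_distrib, h, add_assoc]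

lemma iterate_negLaplacian_bracket_rpow {n : ℕ} (s : ℝ) (i : ℕ) :
    negLaplacian^[i] (fun x : EuclideanSpace ℝ (Fin n) => (1 + ‖x‖ ^ 2) ^ s) =
      fun x => ∑ j ∈ Finset.range (i + 1),
        polyLaplaceCoeff n s i j * (1 + ‖x‖ ^ 2) ^ (s - i - j) := by
  induction i with
  | zero => ext x; simp [polyLaplaceCoeff]
  | succ i ih =>
    ext x
    rw [Function.iterate_succ_apply', ih, negLaplacian_sum_bracket_rpow]
    have h0 : polyLaplaceCoeff n s i (i + 1) = 0 := by simp [polyLaplaceCoeff]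
    have h1 := sum_range_add_shift (i + 1)
      (fun j => polyLaplaceCoeff n s i j *
        (4 * (s - i - j) * (s - i - j - 1) * (1 + ‖x‖ ^ 2) ^ (s - i - j - 2)))
      (fun j : ℕ => polyLaplaceCoeff n s i j *
        -(2 * (s - i - j) * (n + 2 * (s - i - j) - 2) * (1 + ‖x‖ ^ 2) ^ (s - i - j - 1)))
      (by simp [h0])
    refine ((Finset.sum_congr rfl fun j _ => ?_).trans h1).trans ?_
    · ring
    rw [Finset.sum_range_succ' _ (i + 1), polyLaplaceCoeff_zero_right]
    congr 1
    · refine Finset.sum_congr rfl fun j _ => ?_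
      rw [polyLaplaceCoeff_succ_succ]
      push_cast
      rw [show s - (i + 1) - (j + 1) = s - i - j - 2 by ring,
        show s - i - (j + 1) - 1 = s - i - j - 2 by ring]
      ring
    · push_cast
      rw [show s - (i + 1) - 0 = s - i - 0 - 1 by ring]
      ring

/-! ### Leibniz sums in the scale variable -/

/-- The coefficients of `∂_l^i [l^a (l + q)^(-A)]`. -/
def leibnizCoeff (a A : ℝ) (i j : ℕ) : ℝ :=
  i.choose j * fallingFactorial a (i - j) * fallingFactorial (-A) j

/-- The `i`-th derivative of `l ↦ l^a (l + q)^(-A)`. -/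
def leibnizSum (a A : ℝ) (i : ℕ) (l q : ℝ) : ℝ :=
  ∑ j ∈ Finset.range (i + 1), leibnizCoeff a A i j * (l ^ (a - i + j) * (l + q) ^ (-A - j))

lemma leibnizCoeff_zero_right (a A : ℝ) (i : ℕ) :
    leibnizCoeff a A (i + 1) 0 = (a - i) * leibnizCoeff a A i 0 := by
  simp [leibnizCoeff, fallingFactorial_succ, mul_comm]

lemma leibnizCoeff_succ_succ (a A : ℝ) (i j : ℕ) :
    leibnizCoeff a A (i + 1) (j + 1) =
      (a - i + (j + 1)) * leibnizCoeff a A i (j + 1) + (-A - j) * leibnizCoeff a A i j := by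
  simp only [leibnizCoeff, Nat.add_sub_add_right, fallingFactorial_succ (-A)]
  rcases lt_trichotomy i j with h | h | h
  · simp [Nat.choose_eq_zero_of_lt h, Nat.choose_eq_zero_of_lt (show i < j + 1 by omega),
      Nat.choose_eq_zero_of_lt (show i + 1 < j + 1 by omega)]
  · subst h
    simp
    ring
  · obtain ⟨k, rfl⟩ := Nat.exists_eq_add_of_lt h
    rw [show j + k + 1 - (j + 1) = k by omega, show j + k + 1 - j = k + 1 by omega,
      fallingFactorial_succ, Nat.choose_succ_succ]
    push_cast
    ring

/-- Product rule: differentiating the power of `l` keeps the index `j`, differentiating the power of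
`l + q` raises it by one. -/
lemma hasDerivAt_leibnizSum (a A : ℝ) (i : ℕ) {l q : ℝ} (hl : 0 < l) (hq : 0 ≤ q) :
    HasDerivAt (fun l => leibnizSum a A i l q) (leibnizSum a A (i + 1) l q) l := by
  have hlq : 0 < l + q := by positivity
  have hd : HasDerivAt (fun l => leibnizSum a A i l q)
      (∑ j ∈ Finset.range (i + 1), leibnizCoeff a A i j *
        (1 * (a - i + j) * l ^ (a - i + j - 1) * (l + q) ^ (-A - j) +
          l ^ (a - i + j) * (1 * (-A - j) * (l + q) ^ (-A - j - 1)))) l := by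
    refine HasDerivAt.fun_sum fun j _ => HasDerivAt.const_mul _ (HasDerivAt.mul ?_ ?_)
    · exact (hasDerivAt_id l).rpow_const (Or.inl hl.ne')
    · exact ((hasDerivAt_id l).add_const q).rpow_const (Or.inl hlq.ne')
  refine hd.congr_deriv ?_
  have h0 : leibnizCoeff a A i (i + 1) = 0 := by simp [leibnizCoeff]
  have h1 := sum_range_add_shift (i + 1)
    (fun j => leibnizCoeff a A i j * (l ^ (a - i + j) * (1 * (-A - j) * (l + q) ^ (-A - j - 1))))
    (fun j : ℕ => leibnizCoeff a A i j *
      (1 * (a - i + j) * l ^ (a - i + j - 1) * (l + q) ^ (-A - j))) (by simp [h0])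
  refine ((Finset.sum_congr rfl fun j _ => ?_).trans h1).trans ?_
  · ring
  rw [leibnizSum, Finset.sum_range_succ' _ (i + 1), leibnizCoeff_zero_right]
  congr 1
  · refine Finset.sum_congr rfl fun j _ => ?_
    rw [leibnizCoeff_succ_succ]
    push_cast
    rw [show a - (i + 1) + (j + 1) = a - i + j by ring,
      show a - i + (j + 1) - 1 = a - i + j by ring, show -A - (j + 1 : ℝ) = -A - j - 1 by ring]
    ring
  · push_cast
    rw [show a - (i + 1) + 0 = a - i + 0 - 1 by ring]
    ring

/-! ### Laplacians in space as derivatives in scale -/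

/-- This is what singles out the exponent `s = m - (n+α)/2`: it gives `m - n/2 - s = α/2` and `s - m
= -(n+α)/2`, precisely the two exponents of the Leibniz product. -/
lemma polyLaplaceCoeff_eq_leibnizCoeff (n m j : ℕ) (α : ℝ) :
    polyLaplaceCoeff n (m - (n + α) / 2) m j =
      4 ^ m * fallingFactorial (m - (n + α) / 2) m * leibnizCoeff (α / 2) ((n + α) / 2) m j := by
  rw [polyLaplaceCoeff, leibnizCoeff, fallingFactorial_add,
    show (m : ℝ) - n / 2 - (m - (n + α) / 2) = α / 2 by ring,
    show (m : ℝ) - (n + α) / 2 - m = -((n + α) / 2) by ring]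
  ring

/-- The bracket is, up to a factor `2`, the coefficient in the `t`-derivative of the scaled Leibniz
sum of order `m + 1`. This is why `w̃` gives an exact derivative in `t`. -/
lemma polyLaplaceCoeff_succ_eq_leibnizCoeff (n m j : ℕ) (α : ℝ) :
    polyLaplaceCoeff n (m - (n + α) / 2) (m + 1) j =
      4 ^ (m + 1) * fallingFactorial (m - (n + α) / 2) m *
        ((j + 1) * leibnizCoeff (α / 2) ((n + α) / 2) (m + 1) (j + 1) +
          (-((n + α) / 2) - j) * leibnizCoeff (α / 2) ((n + α) / 2) (m + 1) j) := by
  rw [polyLaplaceCoeff, add_right_comm m 1 j, add_assoc m j 1, fallingFactorial_add,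
    show ((m + 1 : ℕ) : ℝ) - n / 2 - (m - (n + α) / 2) = α / 2 + 1 by push_cast; ring,
    show (m : ℝ) - (n + α) / 2 - m = -((n + α) / 2) by ring]
  simp only [leibnizCoeff, Nat.add_sub_add_right, fallingFactorial_succ (-((n + α) / 2))]
  have hc : ((m + 1).choose (j + 1) : ℝ) * (j + 1) = (m + 1).choose j * ((m + 1 - j : ℕ) : ℝ) := by
    exact_mod_cast Nat.choose_succ_right_eq (m + 1) j
  rcases Nat.lt_or_ge m j with h | h
  · rcases Nat.eq_or_lt_of_le h with h | h
    · subst h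
      simp
      ring
    · simp [Nat.choose_eq_zero_of_lt h, Nat.choose_eq_zero_of_lt (show m + 1 < j + 1 by omega)]
  · obtain ⟨k, rfl⟩ := Nat.exists_eq_add_of_le h
    rw [show j + k + 1 - j = k + 1 by omega] at hc ⊢
    rw [show j + k - j = k by omega, fallingFactorial_add_one_succ, fallingFactorial_succ]
    push_cast at hc ⊢
    linear_combination (-4 ^ (j + k + 1) * fallingFactorial (j + k - (n + α) / 2) (j + k) *
      fallingFactorial (α / 2) k * (fallingFactorial (-((n + α) / 2)) j * (-((n + α) / 2) - j))) * hc

lemma recon_eq (n m : ℕ) (α : ℝ) (x : EuclideanSpace ℝ (Fin n)) :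
    recon n m α x = 4 ^ m * fallingFactorial (m - (n + α) / 2) m *
      ∑ j ∈ Finset.range (m + 1), leibnizCoeff (α / 2) ((n + α) / 2) m j *
        (1 + ‖x‖ ^ 2) ^ (-((n + α) / 2) - j) := by
  rw [recon, iterate_negLaplacian_bracket_rpow, Finset.mul_sum]
  refine Finset.sum_congr rfl fun j _ => ?_
  rw [polyLaplaceCoeff_eq_leibnizCoeff,
    show (m : ℝ) - (n + α) / 2 - m = -((n + α) / 2) by ring]
  ring

lemma reconTilde_eq (n m : ℕ) (α : ℝ) (x : EuclideanSpace ℝ (Fin n)) :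
    reconTilde n m α x = ∑ j ∈ Finset.range (m + 2),
      polyLaplaceCoeff n (m - (n + α) / 2) (m + 1) j *
        (1 + ‖x‖ ^ 2) ^ (-((n + α) / 2) - 1 - j) := by
  have : reconTilde n m α = negLaplacian^[m + 1]
      (fun x : EuclideanSpace ℝ (Fin n) => (1 + ‖x‖ ^ 2) ^ ((m : ℝ) - ((n : ℝ) + α) / 2)) := by
    rw [Function.iterate_succ_apply']; rfl
  rw [this, iterate_negLaplacian_bracket_rpow]
  refine Finset.sum_congr rfl fun j _ => ?_
  rw [show (m : ℝ) - (n + α) / 2 - ((m + 1 : ℕ) : ℝ) = -((n + α) / 2) - 1 by push_cast; ring]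

/-! ### Scaled Leibniz sums: decay and derivative in `t` -/

/-- `t^(2i-2a)` times `leibnizSum a A i (t²) q`. -/
def scaledLeibnizSum (a A : ℝ) (i : ℕ) (t q : ℝ) : ℝ :=
  ∑ j ∈ Finset.range (i + 1), leibnizCoeff a A i j * ((t ^ 2) ^ j * (t ^ 2 + q) ^ (-A - j))

lemma scaledLeibnizSum_eq (a A : ℝ) (i : ℕ) {t : ℝ} (ht : 0 < t) (q : ℝ) :
    scaledLeibnizSum a A i t q = t ^ (2 * i - 2 * a) * leibnizSum a A i (t ^ 2) q := by
  rw [scaledLeibnizSum, leibnizSum, Finset.mul_sum]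
  refine Finset.sum_congr rfl fun j _ => ?_
  have : (t ^ 2) ^ j = t ^ (2 * i - 2 * a) * (t ^ 2) ^ (a - i + j) := by
    rw [← Real.rpow_natCast t 2, ← Real.rpow_mul ht.le, ← Real.rpow_natCast _ j,
      ← Real.rpow_mul ht.le, ← Real.rpow_add ht]
    congr 1
    push_cast; ring
  rw [this]; ring

lemma pow_mul_rpow_sub_le {l q : ℝ} (hl : 0 < l) (hq : 0 ≤ q) (τ : ℝ) (j : ℕ) :
    l ^ j * (l + q) ^ (τ - j) ≤ (l + q) ^ τ := by
  have h : 0 < l + q := by positivity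
  rw [Real.rpow_sub_natCast h.ne', ← mul_div_assoc, mul_comm, mul_div_assoc]
  refine mul_le_of_le_one_right (by positivity) ?_
  rw [div_le_one (by positivity)]
  gcongr
  linarith

lemma abs_scaledLeibnizSum_le (a A : ℝ) (i : ℕ) {t q : ℝ} (ht : 0 < t) (hq : 0 ≤ q) :
    |scaledLeibnizSum a A i t q| ≤
      (∑ j ∈ Finset.range (i + 1), |leibnizCoeff a A i j|) * (t ^ 2 + q) ^ (-A) := by
  rw [scaledLeibnizSum, Finset.sum_mul]
  refine (Finset.abs_sum_le_sum_abs _ _).trans (Finset.sum_le_sum fun j _ => ?_)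
  rw [abs_mul, abs_of_nonneg (by positivity : 0 ≤ (t ^ 2) ^ j * (t ^ 2 + q) ^ (-A - j))]
  gcongr
  exact pow_mul_rpow_sub_le (by positivity) hq _ _

lemma tendsto_sq_add_rpow_neg {A : ℝ} (hA : 0 < A) (q : ℝ) :
    Tendsto (fun t : ℝ => (t ^ 2 + q) ^ (-A)) atTop (𝓝 0) :=
  (tendsto_rpow_neg_atTop hA).comp
    (tendsto_atTop_add_const_right _ q (tendsto_pow_atTop two_ne_zero))

lemma tendsto_scaledLeibnizSum (a : ℝ) {A : ℝ} (hA : 0 < A) (i : ℕ) {q : ℝ} (hq : 0 ≤ q) :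
    Tendsto (fun t => scaledLeibnizSum a A i t q) atTop (𝓝 0) := by
  have h := (tendsto_sq_add_rpow_neg hA q).const_mul
    (∑ j ∈ Finset.range (i + 1), |leibnizCoeff a A i j|)
  rw [mul_zero] at h
  refine squeeze_zero_norm' ?_ h
  filter_upwards [eventually_gt_atTop 0] with t ht using abs_scaledLeibnizSum_le a A i ht hq

lemma hasDerivAt_scaledLeibnizSum (a A : ℝ) (i : ℕ) {t q : ℝ} (ht : 0 < t) (hq : 0 ≤ q) :
    HasDerivAt (fun t => scaledLeibnizSum a A i t q)
      (∑ j ∈ Finset.range (i + 1), 2 * ((j + 1) * leibnizCoeff a A i (j + 1) +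
        (-A - j) * leibnizCoeff a A i j) * (t ^ (2 * j + 1) * (t ^ 2 + q) ^ (-A - 1 - j))) t := by
  have hlq : 0 < t ^ 2 + q := by positivity
  have hd : HasDerivAt (fun t => scaledLeibnizSum a A i t q)
      (∑ j ∈ Finset.range (i + 1), leibnizCoeff a A i j *
        (((2 * j : ℕ) : ℝ) * t ^ (2 * j - 1) * (t ^ 2 + q) ^ (-A - j) +
          t ^ (2 * j) * (2 * t * (-A - j) * (t ^ 2 + q) ^ (-A - j - 1)))) t := by
    unfold scaledLeibnizSum
    simp only [← pow_mul]
    refine HasDerivAt.fun_sum fun j _ => HasDerivAt.const_mul _ (HasDerivAt.mul ?_ ?_)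
    · exact hasDerivAt_pow _ _
    · have := ((hasDerivAt_pow 2 t).add_const q).rpow_const (p := -A - j) (Or.inl hlq.ne')
      simpa using this
  refine hd.congr_deriv ?_
  have h0 : leibnizCoeff a A i (i + 1) = 0 := by simp [leibnizCoeff]
  have h1 := sum_range_add_shift (i + 1)
    (fun j => leibnizCoeff a A i j *
      (t ^ (2 * j) * (2 * t * (-A - j) * (t ^ 2 + q) ^ (-A - j - 1))))
    (fun j : ℕ => leibnizCoeff a A i j *
      (((2 * j : ℕ) : ℝ) * t ^ (2 * j - 1) * (t ^ 2 + q) ^ (-A - j))) (by simp [h0])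
  refine ((Finset.sum_congr rfl fun j _ => ?_).trans h1).trans ?_
  · ring
  -- The boundary term at `j = 0` disappears because `(t²)^0` is constant; hence the derivative has
  -- no power `t^(-1)`.
  simp only [mul_zero, Nat.cast_zero, zero_mul, add_zero]
  refine Finset.sum_congr rfl fun j _ => ?_
  rw [show 2 * (j + 1) - 1 = 2 * j + 1 by omega]
  push_cast
  rw [show -A - (j + 1 : ℝ) = -A - 1 - j by ring, show -A - (j : ℝ) - 1 = -A - 1 - j by ring]
  ring

/-! ### The dilated kernels `w_t` and `w̃_t` -/

section Kernels

variable {n : ℕ}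

lemma bracket_smul_rpow {t : ℝ} (ht : 0 < t) (τ : ℝ) (x : EuclideanSpace ℝ (Fin n)) :
    (1 + ‖t⁻¹ • x‖ ^ 2) ^ τ = t ^ (-(2 * τ)) * (t ^ 2 + ‖x‖ ^ 2) ^ τ := by
  have : 1 + ‖t⁻¹ • x‖ ^ 2 = (t ^ 2)⁻¹ * (t ^ 2 + ‖x‖ ^ 2) := by
    rw [norm_smul, Real.norm_of_nonneg (by positivity)]
    field_simp
  rw [this, Real.mul_rpow (by positivity) (by positivity), Real.inv_rpow (by positivity),
    ← Real.rpow_natCast t 2, ← Real.rpow_mul ht.le, ← Real.rpow_neg ht.le]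
  norm_num

lemma inv_pow_mul_rpow_neg {t : ℝ} (ht : 0 < t) (k : ℕ) (r : ℝ) :
    t ^ (-r) * (t ^ n)⁻¹ * t ^ (n + r + k) = t ^ k := by
  rw [Real.rpow_add_natCast ht.ne', Real.rpow_add ht, Real.rpow_neg ht.le, Real.rpow_natCast]
  field_simp

/-- The constant `4^m s (s - 1) ⋯ (s - m + 1)` with `s = m - (n + α) / 2`. -/
def reconConst (n m : ℕ) (α : ℝ) : ℝ := 4 ^ m * fallingFactorial (m - (n + α) / 2) m

lemma rpow_neg_mul_dilate_recon (m : ℕ) (α : ℝ) {t : ℝ} (ht : 0 < t)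
    (x : EuclideanSpace ℝ (Fin n)) :
    t ^ (-α) * dilate (recon n m α) t x =
      reconConst n m α * scaledLeibnizSum (α / 2) ((n + α) / 2) m t (‖x‖ ^ 2) := by
  rw [dilate, recon_eq, scaledLeibnizSum, reconConst]
  simp only [bracket_smul_rpow ht, Finset.mul_sum]
  refine Finset.sum_congr rfl fun j _ => ?_
  rw [show -(2 * (-((n + α) / 2) - j)) = (n : ℝ) + α + (2 * j : ℕ) by push_cast; ring, ← pow_mul,
    ← inv_pow_mul_rpow_neg (n := n) ht (2 * j) α]
  ring

lemma inv_rpow_mul_dilate_reconTilde (m : ℕ) (α : ℝ) {t : ℝ} (ht : 0 < t)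
    (x : EuclideanSpace ℝ (Fin n)) :
    (t ^ (1 + α))⁻¹ * dilate (reconTilde n m α) t x =
      ∑ j ∈ Finset.range (m + 2), polyLaplaceCoeff n (m - (n + α) / 2) (m + 1) j *
        (t ^ (2 * j + 1) * (t ^ 2 + ‖x‖ ^ 2) ^ (-((n + α) / 2) - 1 - j)) := by
  rw [dilate, reconTilde_eq]
  simp only [bracket_smul_rpow ht, Finset.mul_sum]
  refine Finset.sum_congr rfl fun j _ => ?_
  rw [show -(2 * (-((n + α) / 2) - 1 - j)) = (n : ℝ) + (1 + α) + (2 * j + 1 : ℕ) by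
    push_cast; ring, ← inv_pow_mul_rpow_neg (n := n) ht (2 * j + 1) (1 + α), Real.rpow_neg ht.le]
  ring

lemma hasDerivAt_scaledLeibnizSum_reconTilde (m : ℕ) (α : ℝ) {t : ℝ} (ht : 0 < t)
    (x : EuclideanSpace ℝ (Fin n)) :
    HasDerivAt (fun t => 2 * reconConst n m α *
        scaledLeibnizSum (α / 2) ((n + α) / 2) (m + 1) t (‖x‖ ^ 2))
      ((t ^ (1 + α))⁻¹ * dilate (reconTilde n m α) t x) t := by
  refine ((hasDerivAt_scaledLeibnizSum (α / 2) ((n + α) / 2) (m + 1) ht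
    (sq_nonneg ‖x‖)).const_mul (2 * reconConst n m α)).congr_deriv ?_
  rw [inv_rpow_mul_dilate_reconTilde m α ht, Finset.mul_sum]
  refine Finset.sum_congr rfl fun j _ => ?_
  rw [polyLaplaceCoeff_succ_eq_leibnizCoeff, reconConst]
  ring

/-- The exponent is one lower than `-(n+α)/2`: integrating the bound over `t > ε` gives back the
decay `-(n+α)/2` in space, for which the Riesz potential is under control. -/
lemma exists_abs_dilate_reconTilde_le (n m : ℕ) (α : ℝ) :
    ∃ C : ℝ, 0 ≤ C ∧ ∀ (t : ℝ), 0 < t → ∀ x : EuclideanSpace ℝ (Fin n),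
      |(t ^ (1 + α))⁻¹ * dilate (reconTilde n m α) t x| ≤
        C * (t * (t ^ 2 + ‖x‖ ^ 2) ^ (-((n + α) / 2) - 1)) := by
  refine ⟨∑ j ∈ Finset.range (m + 2), |polyLaplaceCoeff n (m - (n + α) / 2) (m + 1) j|,
    by positivity, fun t ht x => ?_⟩
  rw [inv_rpow_mul_dilate_reconTilde m α ht, Finset.sum_mul]
  refine (Finset.abs_sum_le_sum_abs _ _).trans (Finset.sum_le_sum fun j _ => ?_)
  rw [abs_mul, abs_of_nonneg (by positivity :
    0 ≤ t ^ (2 * j + 1) * (t ^ 2 + ‖x‖ ^ 2) ^ (-((n + α) / 2) - 1 - j)), pow_succ', pow_mul,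
    mul_assoc]
  gcongr
  exact pow_mul_rpow_sub_le (by positivity) (by positivity) _ _

/-- The antiderivative is explicit. It serves for the scale integral of `w̃_t` and, with `t` fixed
and the radius as variable, for the decomposition of the final kernel into balls. -/
lemma lintegral_mul_sq_add_rpow {A q ε : ℝ} (hA : 0 < A) (hq : 0 ≤ q) (hε : 0 < ε) :
    ∫⁻ t in Ioi ε, ENNReal.ofReal (t * (t ^ 2 + q) ^ (-A - 1)) =
      ENNReal.ofReal ((2 * A)⁻¹ * (ε ^ 2 + q) ^ (-A)) := by
  have hd : ∀ t ∈ Ici ε, HasDerivAt (fun t : ℝ => -(2 * A)⁻¹ * (t ^ 2 + q) ^ (-A))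
      (t * (t ^ 2 + q) ^ (-A - 1)) t := by
    intro t ht
    have ht : 0 < t := hε.trans_le ht
    have := (((hasDerivAt_pow 2 t).add_const q).rpow_const (p := -A)
      (Or.inl (by positivity))).const_mul (-(2 * A)⁻¹)
    refine this.congr_deriv ?_
    push_cast
    field_simp
  have hpos : ∀ t ∈ Ioi ε, 0 ≤ t * (t ^ 2 + q) ^ (-A - 1) := fun t ht => by
    have : 0 < t := hε.trans ht
    positivity
  have hlim := (tendsto_sq_add_rpow_neg hA q).const_mul (-(2 * A)⁻¹)
  rw [mul_zero] at hlim
  have hint := integrableOn_Ioi_deriv_of_nonneg' hd hpos hlim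
  rw [← ofReal_integral_eq_lintegral_ofReal hint
    ((ae_restrict_iff' measurableSet_Ioi).2 (ae_of_all _ hpos)),
    integral_Ioi_of_hasDerivAt_of_tendsto' hd hint hlim]
  congr 1
  ring

lemma continuousOn_dilate_reconTilde (m : ℕ) (α : ℝ) :
    ContinuousOn (fun z : ℝ × EuclideanSpace ℝ (Fin n) =>
      (z.1 ^ (1 + α))⁻¹ * dilate (reconTilde n m α) z.1 z.2) (Ioi 0 ×ˢ univ) := by
  have : ContinuousOn (fun z : ℝ × EuclideanSpace ℝ (Fin n) => ∑ j ∈ Finset.range (m + 2),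
      polyLaplaceCoeff n (m - (n + α) / 2) (m + 1) j *
        (z.1 ^ (2 * j + 1) * (z.1 ^ 2 + ‖z.2‖ ^ 2) ^ (-((n + α) / 2) - 1 - j)))
      (Ioi 0 ×ˢ univ) := by
    refine continuousOn_finsetSum _ fun j _ => continuousOn_const.mul (ContinuousOn.mul
      (by fun_prop) (ContinuousOn.rpow_const (by fun_prop) fun z hz => Or.inl ?_))
    have : 0 < z.1 := hz.1
    positivity
  exact this.congr fun z hz => inv_rpow_mul_dilate_reconTilde m α hz.1 z.2

lemma integral_dilate_reconTilde (m : ℕ) {α ε : ℝ} (hα : 0 < α) (hε : 0 < ε)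
    (x : EuclideanSpace ℝ (Fin n)) :
    ∫ t in Ioi ε, (t ^ (1 + α))⁻¹ * dilate (reconTilde n m α) t x =
      -(2 * reconConst n m α) *
        scaledLeibnizSum (α / 2) ((n + α) / 2) (m + 1) ε (‖x‖ ^ 2) := by
  have hA : 0 < (n + α) / 2 := by positivity
  obtain ⟨C, hC, hb⟩ := exists_abs_dilate_reconTilde_le n m α
  have hd : ∀ t ∈ Ici ε, HasDerivAt _ _ t := fun t ht =>
    hasDerivAt_scaledLeibnizSum_reconTilde m α (hε.trans_le ht) x
  have hlim := (tendsto_scaledLeibnizSum (α / 2) hA (m + 1) (sq_nonneg ‖x‖)).const_mul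
    (2 * reconConst n m α)
  rw [mul_zero] at hlim
  have hint : IntegrableOn (fun t => (t ^ (1 + α))⁻¹ * dilate (reconTilde n m α) t x)
      (Ioi ε) := by
    refine ⟨?_, ?_⟩
    · refine ContinuousOn.aestronglyMeasurable ?_ measurableSet_Ioi
      exact (continuousOn_dilate_reconTilde m α).comp (f := fun t : ℝ => (t, x))
        (by fun_prop) fun t ht => ⟨hε.trans ht, mem_univ _⟩
    · refine (setLIntegral_mono_ae' (g := fun t => ENNReal.ofReal C *
        ENNReal.ofReal (t * (t ^ 2 + ‖x‖ ^ 2) ^ (-((n + α) / 2) - 1)))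
        measurableSet_Ioi (ae_of_all _ fun t ht => ?_)).trans_lt ?_
      · rw [← ENNReal.ofReal_mul hC, ← ofReal_norm]
        exact ENNReal.ofReal_le_ofReal (hb t (hε.trans ht) x)
      · rw [lintegral_const_mul' _ _ ENNReal.ofReal_ne_top,
          lintegral_mul_sq_add_rpow hA (sq_nonneg _) hε]
        exact ENNReal.mul_lt_top ENNReal.ofReal_lt_top ENNReal.ofReal_lt_top
  rw [integral_Ioi_of_hasDerivAt_of_tendsto' hd hint hlim]
  ring

end Kernels

/-! ### Gamma and beta integrals -/

lemma lintegral_rpow_mul_exp_neg_mul {a r : ℝ} (ha : 0 < a) (hr : 0 < r) :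
    ∫⁻ u in Ioi (0 : ℝ), ENNReal.ofReal (u ^ (a - 1) * Real.exp (-(r * u))) =
      ENNReal.ofReal (Real.Gamma a * r ^ (-a)) := by
  have hint : IntegrableOn (fun u : ℝ => u ^ (a - 1) * Real.exp (-(r * u))) (Ioi 0) := by
    have := integrableOn_rpow_mul_exp_neg_mul_rpow (s := a - 1) (p := 1) (b := r)
      (by linarith) one_pos hr
    simpa [neg_mul] using this
  rw [← ofReal_integral_eq_lintegral_ofReal hint
    ((ae_restrict_iff' measurableSet_Ioi).2 (ae_of_all _ fun u hu => by
      have : 0 < u := hu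
      positivity)), Real.integral_rpow_mul_exp_neg_mul_Ioi ha hr, one_div, Real.inv_rpow hr.le,
    Real.rpow_neg hr.le, mul_comm]

/-- A beta integral: expand `(P + Q z)^(-(a+b))` as a Gamma integral in `u`, then integrate in `z`
first. Working in `ℝ≥0∞`, Tonelli needs no prior integrability. -/
lemma lintegral_rpow_mul_add_rpow {a b P Q : ℝ} (ha : 0 < a) (hb : 0 < b) (hP : 0 < P)
    (hQ : 0 < Q) :
    ENNReal.ofReal (Real.Gamma (a + b)) *
      ∫⁻ z in Ioi (0 : ℝ), ENNReal.ofReal (z ^ (a - 1) * (P + Q * z) ^ (-(a + b))) =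
      ENNReal.ofReal (Real.Gamma a * Real.Gamma b * Q ^ (-a) * P ^ (-b)) := by
  have hab : 0 < a + b := add_pos ha hb
  calc _ = ∫⁻ z in Ioi (0 : ℝ), ∫⁻ u in Ioi (0 : ℝ),
        ENNReal.ofReal (z ^ (a - 1)) *
          ENNReal.ofReal (u ^ (a + b - 1) * Real.exp (-((P + Q * z) * u))) := by
        rw [← lintegral_const_mul' _ _ ENNReal.ofReal_ne_top]
        refine setLIntegral_congr_fun measurableSet_Ioi fun z hz => ?_
        have hz : 0 < z := hz
        rw [lintegral_const_mul' _ _ ENNReal.ofReal_ne_top,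
          lintegral_rpow_mul_exp_neg_mul hab (by positivity),
          ← ENNReal.ofReal_mul (Real.Gamma_pos_of_pos hab).le,
          ← ENNReal.ofReal_mul (by positivity)]
        ring_nf
    _ = ∫⁻ u in Ioi (0 : ℝ), ∫⁻ z in Ioi (0 : ℝ),
        ENNReal.ofReal (z ^ (a - 1)) *
          ENNReal.ofReal (u ^ (a + b - 1) * Real.exp (-((P + Q * z) * u))) :=
        lintegral_lintegral_swap (Measurable.aemeasurable (by fun_prop))
    _ = ∫⁻ u in Ioi (0 : ℝ), ENNReal.ofReal (Real.Gamma a * Q ^ (-a)) *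
          ENNReal.ofReal (u ^ (b - 1) * Real.exp (-(P * u))) := by
        refine setLIntegral_congr_fun measurableSet_Ioi fun u hu => ?_
        have hu : 0 < u := hu
        have : ∀ z ∈ Ioi (0 : ℝ), ENNReal.ofReal (z ^ (a - 1)) *
            ENNReal.ofReal (u ^ (a + b - 1) * Real.exp (-((P + Q * z) * u))) =
            ENNReal.ofReal (u ^ (a + b - 1) * Real.exp (-(P * u))) *
              ENNReal.ofReal (z ^ (a - 1) * Real.exp (-((Q * u) * z))) := by
          intro z hz
          have hz : 0 < z := hz
          rw [← ENNReal.ofReal_mul (by positivity), ← ENNReal.ofReal_mul (by positivity),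
            show -((P + Q * z) * u) = -(P * u) + -((Q * u) * z) by ring, Real.exp_add]
          ring_nf
        rw [setLIntegral_congr_fun measurableSet_Ioi this,
          lintegral_const_mul' _ _ ENNReal.ofReal_ne_top,
          lintegral_rpow_mul_exp_neg_mul ha (by positivity),
          ← ENNReal.ofReal_mul (by positivity), ← ENNReal.ofReal_mul (by positivity),
          Real.mul_rpow hQ.le hu.le, show a + b - 1 = b - 1 + a by ring, Real.rpow_add hu,
          Real.rpow_neg hu.le a]
        congr 1
        have : u ^ a ≠ 0 := by positivity
        field_simp
    _ = _ := by
        rw [lintegral_const_mul' _ _ ENNReal.ofReal_ne_top, lintegral_rpow_mul_exp_neg_mul hb hP,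
          ← ENNReal.ofReal_mul (by positivity)]
        ring_nf

lemma lintegral_Ioi_comp_mul_left {u : ℝ} (hu : 0 < u) (F : ℝ → ℝ≥0∞) :
    ∫⁻ v in Ioi (0 : ℝ), F v = ∫⁻ z in Ioi (0 : ℝ), ENNReal.ofReal u * F (u * z) := by
  have h := lintegral_image_eq_lintegral_abs_deriv_mul (s := Ioi (0 : ℝ)) (f := fun z => u * z)
    (f' := fun _ => u) measurableSet_Ioi
    (fun z _ => by simpa using ((hasDerivAt_id z).const_mul u).hasDerivWithinAt)
    (fun z _ w _ h => mul_left_cancel₀ hu.ne' h) F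
  rw [image_mul_left_Ioi hu, mul_zero, abs_of_pos hu] at h
  exact h

/-! ### The Riesz potential of `(l + |y|²)^(-(n+α)/2)` through Gaussians -/

section Gaussian

variable {n : ℕ}

lemma lintegral_exp_neg_mul_sq_norm {b : ℝ} (hb : 0 < b) :
    ∫⁻ y : EuclideanSpace ℝ (Fin n), ENNReal.ofReal (Real.exp (-(b * ‖y‖ ^ 2))) =
      ENNReal.ofReal ((Real.pi / b) ^ ((n : ℝ) / 2)) := by
  have h := GaussianFourier.integral_rexp_neg_mul_sq_norm (V := EuclideanSpace ℝ (Fin n)) hb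
  have hi : Integrable (fun y : EuclideanSpace ℝ (Fin n) => Real.exp (-b * ‖y‖ ^ 2)) := by
    refine Integrable.of_integral_ne_zero ?_
    rw [h]
    positivity
  rw [finrank_euclideanSpace_fin] at h
  simp only [neg_mul] at h hi
  rw [← h, ofReal_integral_eq_lintegral_ofReal hi (ae_of_all _ fun y => (Real.exp_pos _).le)]

lemma lintegral_exp_neg_sq_norm_sub {u v : ℝ} (hu : 0 < u) (hv : 0 < v)
    (x : EuclideanSpace ℝ (Fin n)) :
    ∫⁻ y : EuclideanSpace ℝ (Fin n),
        ENNReal.ofReal (Real.exp (-(v * ‖x - y‖ ^ 2 + u * ‖y‖ ^ 2))) =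
      ENNReal.ofReal ((Real.pi / (u + v)) ^ ((n : ℝ) / 2) *
        Real.exp (-(u * v / (u + v) * ‖x‖ ^ 2))) := by
  have hsq : ∀ y : EuclideanSpace ℝ (Fin n), v * ‖x - y‖ ^ 2 + u * ‖y‖ ^ 2 =
      (u + v) * ‖y - (v / (u + v)) • x‖ ^ 2 + u * v / (u + v) * ‖x‖ ^ 2 := by
    intro y
    rw [norm_sub_sq_real, norm_sub_sq_real, inner_smul_right, norm_smul, real_inner_comm x y,
      Real.norm_of_nonneg (by positivity)]
    field_simp
    ring
  simp only [hsq, neg_add, Real.exp_add, ENNReal.ofReal_mul (Real.exp_pos _).le]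
  rw [lintegral_mul_const' _ _ ENNReal.ofReal_ne_top,
    lintegral_sub_right_eq_self
      (fun y : EuclideanSpace ℝ (Fin n) => ENNReal.ofReal (Real.exp (-((u + v) * ‖y‖ ^ 2)))),
    lintegral_exp_neg_mul_sq_norm (by positivity), ENNReal.ofReal_mul (by positivity)]

/-- `π^(n/2) Γ(b - n/2) / Γ(b)`, the integral of `(1 + |x|²)^(-b)`. -/
def bracketMass (n : ℕ) (b : ℝ) : ℝ :=
  Real.pi ^ ((n : ℝ) / 2) * Real.Gamma (b - n / 2) / Real.Gamma b

lemma lintegral_bracket_rpow {b l : ℝ} (hb : (n : ℝ) / 2 < b) (hl : 0 < l) :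
    ∫⁻ x : EuclideanSpace ℝ (Fin n), ENNReal.ofReal ((l + ‖x‖ ^ 2) ^ (-b)) =
      ENNReal.ofReal (bracketMass n b * l ^ (-(b - n / 2))) := by
  have hb0 : 0 < b := lt_of_le_of_lt (by positivity) hb
  have hG := Real.Gamma_pos_of_pos hb0
  have hG' : ENNReal.ofReal (Real.Gamma b) ≠ 0 := by simpa using hG
  rw [bracketMass, div_mul_eq_mul_div, ENNReal.ofReal_div_of_pos hG,
    ENNReal.eq_div_iff hG' ENNReal.ofReal_ne_top]
  calc _ = ∫⁻ x : EuclideanSpace ℝ (Fin n), ∫⁻ u in Ioi (0 : ℝ),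
        ENNReal.ofReal (u ^ (b - 1) * Real.exp (-((l + ‖x‖ ^ 2) * u))) := by
        rw [← lintegral_const_mul' _ _ ENNReal.ofReal_ne_top]
        refine lintegral_congr fun x => ?_
        rw [lintegral_rpow_mul_exp_neg_mul hb0 (by positivity), ENNReal.ofReal_mul hG.le]
    _ = ∫⁻ u in Ioi (0 : ℝ), ∫⁻ x : EuclideanSpace ℝ (Fin n),
        ENNReal.ofReal (u ^ (b - 1) * Real.exp (-((l + ‖x‖ ^ 2) * u))) :=
        lintegral_lintegral_swap (Measurable.aemeasurable (by fun_prop))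
    _ = ∫⁻ u in Ioi (0 : ℝ), ENNReal.ofReal (Real.pi ^ ((n : ℝ) / 2)) *
          ENNReal.ofReal (u ^ (b - n / 2 - 1) * Real.exp (-(l * u))) := by
        refine setLIntegral_congr_fun measurableSet_Ioi fun u hu => ?_
        have hu : 0 < u := hu
        have : ∀ x : EuclideanSpace ℝ (Fin n), -((l + ‖x‖ ^ 2) * u) =
          -(l * u) + -(u * ‖x‖ ^ 2) := fun x => by ring
        simp only [this, Real.exp_add, ← mul_assoc]
        simp only [ENNReal.ofReal_mul (show 0 ≤ u ^ (b - 1) * Real.exp (-(l * u)) by positivity)]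
        rw [lintegral_const_mul' _ _ ENNReal.ofReal_ne_top, lintegral_exp_neg_mul_sq_norm hu,
          ← ENNReal.ofReal_mul (by positivity), ← ENNReal.ofReal_mul (by positivity),
          Real.div_rpow Real.pi_pos.le hu.le, show b - n / 2 - 1 = b - 1 - n / 2 by ring,
          Real.rpow_sub hu (b - 1)]
        congr 1
        field_simp
    _ = _ := by
        rw [lintegral_const_mul' _ _ ENNReal.ofReal_ne_top,
          lintegral_rpow_mul_exp_neg_mul (by linarith) hl,
          ← ENNReal.ofReal_mul (by positivity), mul_assoc]

lemma ae_ne_volume (hn : n ≠ 0) (x : EuclideanSpace ℝ (Fin n)) :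
    ∀ᵐ y : EuclideanSpace ℝ (Fin n), y ≠ x := by
  have : Nonempty (Fin n) := ⟨⟨0, Nat.pos_of_ne_zero hn⟩⟩
  have : Nontrivial (EuclideanSpace ℝ (Fin n)) := inferInstance
  exact compl_mem_ae_iff.2 (measure_singleton x)

/-- Both factors are Gamma integrals of Gaussians, with parameters `u` and `v`. Integrating in `y`
by completing the square, then putting `v = u z` and integrating in `u`, leaves a beta integral in
`z`. -/
lemma lintegral_riesz_bracket {α l : ℝ} (hα : 0 < α) (hαn : α < n) (hl : 0 < l)
    (x : EuclideanSpace ℝ (Fin n)) :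
    ∫⁻ y : EuclideanSpace ℝ (Fin n), ENNReal.ofReal
        ((‖x - y‖ ^ ((n : ℝ) - α))⁻¹ * (l + ‖y‖ ^ 2) ^ (-((n + α) / 2))) =
      ENNReal.ofReal (Real.pi ^ ((n : ℝ) / 2) * Real.Gamma (α / 2) / Real.Gamma ((n + α) / 2) *
        (l ^ (-(α / 2)) * (l + ‖x‖ ^ 2) ^ (-((n - α) / 2)))) := by
  obtain ⟨B, hB⟩ : ∃ B, B = ((n : ℝ) - α) / 2 := ⟨_, rfl⟩
  obtain ⟨A, hA⟩ : ∃ A, A = ((n : ℝ) + α) / 2 := ⟨_, rfl⟩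
  have hB0 : 0 < B := by rw [hB]; linarith
  have hA0 : 0 < A := by rw [hA]; positivity
  have hn0 : (0 : ℝ) < n := hα.trans hαn
  have hGA := Real.Gamma_pos_of_pos hA0
  have hGB := Real.Gamma_pos_of_pos hB0
  have hGn := Real.Gamma_pos_of_pos (half_pos hn0)
  have hGα := Real.Gamma_pos_of_pos (half_pos hα)
  rw [← hA, ← hB]
  have hGA' : ENNReal.ofReal (Real.Gamma A) ≠ 0 := by simpa using hGA
  have hGB' : ENNReal.ofReal (Real.Gamma B) ≠ 0 := by simpa using hGB
  refine (ENNReal.mul_right_inj hGA' ENNReal.ofReal_ne_top).1 ?_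
  refine (ENNReal.mul_right_inj hGB' ENNReal.ofReal_ne_top).1 ?_
  let Φ : ℝ → ℝ → EuclideanSpace ℝ (Fin n) → ℝ≥0∞ := fun u v y =>
    ENNReal.ofReal (u ^ (A - 1) * Real.exp (-(l * u)) * v ^ (B - 1)) *
      ENNReal.ofReal (Real.exp (-(v * ‖x - y‖ ^ 2 + u * ‖y‖ ^ 2)))
  -- The point `y = x` must be left out: there the inverse power is `0` by convention, while the
  -- Gamma integral diverges.
  have h1 : ∀ y, y ≠ x → ENNReal.ofReal (Real.Gamma B) * (ENNReal.ofReal (Real.Gamma A) *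
      ENNReal.ofReal ((‖x - y‖ ^ ((n : ℝ) - α))⁻¹ * (l + ‖y‖ ^ 2) ^ (-A))) =
      ∫⁻ u in Ioi (0 : ℝ), ∫⁻ v in Ioi (0 : ℝ), Φ u v y := by
    intro y hy
    have hxy : 0 < ‖x - y‖ := norm_pos_iff.2 (sub_ne_zero.2 hy.symm)
    have e : (‖x - y‖ ^ ((n : ℝ) - α))⁻¹ = (‖x - y‖ ^ 2) ^ (-B) := by
      rw [← Real.rpow_natCast ‖x - y‖ 2, ← Real.rpow_mul hxy.le, ← Real.rpow_neg hxy.le, hB]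
      congr 1
      push_cast; ring
    have h2 : ∀ u ∈ Ioi (0 : ℝ), ∫⁻ v in Ioi (0 : ℝ), Φ u v y =
        ENNReal.ofReal (u ^ (A - 1) * Real.exp (-((l + ‖y‖ ^ 2) * u))) *
          ENNReal.ofReal (Real.Gamma B * (‖x - y‖ ^ 2) ^ (-B)) := by
      intro u hu
      have hu : 0 < u := hu
      rw [← lintegral_rpow_mul_exp_neg_mul hB0 (by positivity),
        ← lintegral_const_mul' _ _ ENNReal.ofReal_ne_top]
      refine setLIntegral_congr_fun measurableSet_Ioi fun v hv => ?_
      have hv : 0 < v := hv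
      simp only [Φ]
      rw [← ENNReal.ofReal_mul (by positivity), ← ENNReal.ofReal_mul (by positivity)]
      congr 1
      rw [show -((l + ‖y‖ ^ 2) * u) = -(l * u) + -(u * ‖y‖ ^ 2) by ring, neg_add,
        Real.exp_add, Real.exp_add, mul_comm (‖x - y‖ ^ 2) v]
      ring
    rw [setLIntegral_congr_fun measurableSet_Ioi h2,
      lintegral_mul_const' _ _ ENNReal.ofReal_ne_top,
      lintegral_rpow_mul_exp_neg_mul hA0 (by positivity), e,
      ← ENNReal.ofReal_mul (by positivity), ← ENNReal.ofReal_mul (by positivity),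
      ← ENNReal.ofReal_mul (by positivity)]
    ring_nf
  have hΦ1 : Measurable (fun z : (EuclideanSpace ℝ (Fin n) × ℝ) × ℝ => Φ z.1.2 z.2 z.1.1) := by
    fun_prop
  have hΦ2 : ∀ u, Measurable (fun z : EuclideanSpace ℝ (Fin n) × ℝ => Φ u z.2 z.1) := by
    intro u; fun_prop
  have hn : n ≠ 0 := by rintro rfl; simp at hn0
  calc _ = ∫⁻ y : EuclideanSpace ℝ (Fin n), ∫⁻ u in Ioi (0 : ℝ), ∫⁻ v in Ioi (0 : ℝ),
        Φ u v y := by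
        rw [← lintegral_const_mul' _ _ ENNReal.ofReal_ne_top,
          ← lintegral_const_mul' _ _ ENNReal.ofReal_ne_top]
        exact lintegral_congr_ae ((ae_ne_volume hn x).mono fun y hy => h1 y hy)
    _ = ∫⁻ u in Ioi (0 : ℝ), ∫⁻ v in Ioi (0 : ℝ), ∫⁻ y : EuclideanSpace ℝ (Fin n),
        Φ u v y := by
        rw [lintegral_lintegral_swap (Measurable.aemeasurable hΦ1.lintegral_prod_right')]
        exact lintegral_congr fun u => lintegral_lintegral_swap (hΦ2 u).aemeasurable
    _ = ∫⁻ u in Ioi (0 : ℝ), ∫⁻ z in Ioi (0 : ℝ),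
          ENNReal.ofReal (Real.pi ^ ((n : ℝ) / 2) * z ^ (B - 1) * (1 + z) ^ (-((n : ℝ) / 2))) *
          ENNReal.ofReal (u ^ ((n : ℝ) / 2 - 1) *
            Real.exp (-((l + z / (1 + z) * ‖x‖ ^ 2) * u))) := by
        refine setLIntegral_congr_fun measurableSet_Ioi fun u hu => ?_
        have hu : 0 < u := hu
        rw [lintegral_Ioi_comp_mul_left hu]
        refine setLIntegral_congr_fun measurableSet_Ioi fun z hz => ?_
        have hz : 0 < z := hz
        simp only [Φ]
        rw [lintegral_const_mul' _ _ ENNReal.ofReal_ne_top,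
          lintegral_exp_neg_sq_norm_sub hu (by positivity), ← ENNReal.ofReal_mul (by positivity),
          ← ENNReal.ofReal_mul hu.le, ← ENNReal.ofReal_mul (by positivity)]
        congr 1
        rw [show u + u * z = u * (1 + z) by ring, Real.div_rpow Real.pi_pos.le (by positivity),
          Real.mul_rpow hu.le hz.le, Real.mul_rpow hu.le (by positivity : 0 ≤ 1 + z),
          Real.rpow_neg (by positivity),
          show -((l + z / (1 + z) * ‖x‖ ^ 2) * u) =
            -(l * u) + -(u * (u * z) / (u * (1 + z)) * ‖x‖ ^ 2) by field_simp; ring,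
          Real.exp_add]
        -- Here `A + B = n` enters; one factor `u^(n/2)` cancels against the Gaussian normalization.
        have hpow : u * u ^ (A - 1) * u ^ (B - 1) = u ^ ((n : ℝ) / 2 - 1) * u ^ ((n : ℝ) / 2) := by
          rw [mul_comm u, ← Real.rpow_add_one hu.ne', ← Real.rpow_add hu, ← Real.rpow_add hu]
          congr 1; rw [hA, hB]; ring
        have : 0 < u ^ ((n : ℝ) / 2) := by positivity
        generalize u ^ ((n : ℝ) / 2 - 1) = p at *
        generalize u ^ ((n : ℝ) / 2) = r at *
        field_simp
        linear_combination hpow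
    _ = ∫⁻ z in Ioi (0 : ℝ), ENNReal.ofReal (Real.pi ^ ((n : ℝ) / 2) * Real.Gamma ((n : ℝ) / 2)) *
          ENNReal.ofReal (z ^ (B - 1) * (l + (l + ‖x‖ ^ 2) * z) ^ (-(B + α / 2))) := by
        rw [lintegral_lintegral_swap (Measurable.aemeasurable (by fun_prop))]
        refine setLIntegral_congr_fun measurableSet_Ioi fun z hz => ?_
        have hz : 0 < z := hz
        rw [lintegral_const_mul' _ _ ENNReal.ofReal_ne_top,
          lintegral_rpow_mul_exp_neg_mul (half_pos hn0) (by positivity),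
          ← ENNReal.ofReal_mul (by positivity), ← ENNReal.ofReal_mul (by positivity),
          show B + α / 2 = n / 2 by rw [hB]; ring,
          show l + (l + ‖x‖ ^ 2) * z = (1 + z) * (l + z / (1 + z) * ‖x‖ ^ 2) by field_simp; ring,
          Real.mul_rpow (by positivity) (by positivity)]
        ring_nf
    _ = _ := by
        have hb := lintegral_rpow_mul_add_rpow hB0 (half_pos hα) hl
          (show 0 < l + ‖x‖ ^ 2 by positivity)
        -- The beta exponents `B` and `α/2` add up to `n/2`, so `Γ(n/2)` cancels.
        rw [show B + α / 2 = n / 2 by rw [hB]; ring] at hb ⊢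
        rw [lintegral_const_mul' _ _ ENNReal.ofReal_ne_top, ENNReal.ofReal_mul (by positivity),
          mul_assoc, hb, ← ENNReal.ofReal_mul (by positivity), ← ENNReal.ofReal_mul (by positivity),
          ← ENNReal.ofReal_mul (by positivity)]
        congr 1
        field_simp

end Gaussian

/-! ### Differentiating the Riesz potential in the scale -/

lemma rpow_le_add_rpow_of_mem_Icc {c d l : ℝ} (hc : 0 < c) (hl : l ∈ Icc c d) (e : ℝ) :
    l ^ e ≤ c ^ e + d ^ e := by
  have hl0 : 0 < l := hc.trans_le hl.1
  have hd0 : 0 < d := hl0.trans_le hl.2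
  rcases le_total 0 e with he | he
  · have := Real.rpow_le_rpow hl0.le hl.2 he
    have : 0 ≤ c ^ e := by positivity
    linarith
  · have := Real.rpow_le_rpow_of_nonpos hc hl.1 he
    have : 0 ≤ d ^ e := by positivity
    linarith

lemma abs_leibnizSum_le (a A : ℝ) (i : ℕ) {l q : ℝ} (hl : 0 < l) (hq : 0 ≤ q) :
    |leibnizSum a A i l q| ≤
      (∑ j ∈ Finset.range (i + 1), |leibnizCoeff a A i j|) * (l ^ (a - i) * (l + q) ^ (-A)) := by
  rw [leibnizSum, Finset.sum_mul]
  refine (Finset.abs_sum_le_sum_abs _ _).trans (Finset.sum_le_sum fun j _ => ?_)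
  rw [abs_mul, abs_of_nonneg (by positivity : 0 ≤ l ^ (a - i + j) * (l + q) ^ (-A - j)),
    Real.rpow_add_natCast hl.ne', mul_assoc (l ^ (a - i))]
  gcongr
  exact pow_mul_rpow_sub_le hl hq _ _

section Riesz

variable {n : ℕ} {α : ℝ}

lemma continuous_leibnizSum (a A : ℝ) (i : ℕ) {l : ℝ} (hl : 0 < l) :
    Continuous (fun y : EuclideanSpace ℝ (Fin n) => leibnizSum a A i l (‖y‖ ^ 2)) := by
  unfold leibnizSum
  refine continuous_finsetSum _ fun j _ => continuous_const.mul (continuous_const.mul ?_)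
  exact Continuous.rpow_const (by fun_prop) fun y => Or.inl (one_add_norm_sq_pos hl y).ne'

lemma measurable_riesz (x : EuclideanSpace ℝ (Fin n)) :
    Measurable (fun y : EuclideanSpace ℝ (Fin n) => (‖x - y‖ ^ ((n : ℝ) - α))⁻¹) := by
  fun_prop

/-- `π^(n/2) Γ(α/2) / Γ((n+α)/2)`. -/
def rieszBracketConst (n : ℕ) (α : ℝ) : ℝ :=
  Real.pi ^ ((n : ℝ) / 2) * Real.Gamma (α / 2) / Real.Gamma ((n + α) / 2)

lemma integrable_riesz_bracket (hα : 0 < α) (hαn : α < n) {l : ℝ} (hl : 0 < l)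
    (x : EuclideanSpace ℝ (Fin n)) :
    Integrable (fun y : EuclideanSpace ℝ (Fin n) =>
      (‖x - y‖ ^ ((n : ℝ) - α))⁻¹ * (l + ‖y‖ ^ 2) ^ (-((n + α) / 2))) := by
  refine ⟨Measurable.aestronglyMeasurable (by fun_prop), ?_⟩
  rw [hasFiniteIntegral_iff_ofReal (ae_of_all _ fun y => by positivity),
    lintegral_riesz_bracket hα hαn hl]
  exact ENNReal.ofReal_lt_top

lemma integrable_riesz_leibnizSum (hα : 0 < α) (hαn : α < n) (i : ℕ) {l : ℝ} (hl : 0 < l)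
    (x : EuclideanSpace ℝ (Fin n)) :
    Integrable (fun y : EuclideanSpace ℝ (Fin n) =>
      (‖x - y‖ ^ ((n : ℝ) - α))⁻¹ * leibnizSum (α / 2) ((n + α) / 2) i l (‖y‖ ^ 2)) := by
  refine ((integrable_riesz_bracket hα hαn hl x).const_mul ((∑ j ∈ Finset.range (i + 1),
    |leibnizCoeff (α / 2) ((n + α) / 2) i j|) * l ^ (α / 2 - i))).mono'
    ((measurable_riesz x).mul (continuous_leibnizSum _ _ i hl).measurable).aestronglyMeasurable
    (ae_of_all _ fun y => ?_)
  rw [norm_mul, Real.norm_of_nonneg (by positivity : 0 ≤ (‖x - y‖ ^ ((n : ℝ) - α))⁻¹)]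
  have := mul_le_mul_of_nonneg_left
    (abs_leibnizSum_le (α / 2) ((n + α) / 2) i hl (sq_nonneg ‖y‖))
    (by positivity : 0 ≤ (‖x - y‖ ^ ((n : ℝ) - α))⁻¹)
  refine this.trans_eq ?_
  ring

lemma hasDerivAt_integral_riesz_leibnizSum (hα : 0 < α) (hαn : α < n) (i : ℕ) {l : ℝ}
    (hl : 0 < l) (x : EuclideanSpace ℝ (Fin n)) :
    HasDerivAt (fun l => ∫ y : EuclideanSpace ℝ (Fin n),
        (‖x - y‖ ^ ((n : ℝ) - α))⁻¹ * leibnizSum (α / 2) ((n + α) / 2) i l (‖y‖ ^ 2))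
      (∫ y : EuclideanSpace ℝ (Fin n),
        (‖x - y‖ ^ ((n : ℝ) - α))⁻¹ * leibnizSum (α / 2) ((n + α) / 2) (i + 1) l (‖y‖ ^ 2)) l := by
  have hs : Ioo (l / 2) (2 * l) ∈ 𝓝 l := Ioo_mem_nhds (by linarith) (by linarith)
  have hpos : ∀ l' ∈ Ioo (l / 2) (2 * l), 0 < l' := fun l' h => (half_pos hl).trans h.1
  have hA : 0 ≤ (n + α) / 2 := by positivity
  refine (hasDerivAt_integral_of_dominated_loc_of_deriv_le (E := ℝ) (μ := volume)
    (F := fun l (y : EuclideanSpace ℝ (Fin n)) =>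
      (‖x - y‖ ^ ((n : ℝ) - α))⁻¹ * leibnizSum (α / 2) ((n + α) / 2) i l (‖y‖ ^ 2))
    (F' := fun l (y : EuclideanSpace ℝ (Fin n)) =>
      (‖x - y‖ ^ ((n : ℝ) - α))⁻¹ * leibnizSum (α / 2) ((n + α) / 2) (i + 1) l (‖y‖ ^ 2))
    (bound := fun y =>
    ((∑ j ∈ Finset.range (i + 1 + 1), |leibnizCoeff (α / 2) ((n + α) / 2) (i + 1) j|) *
      ((l / 2) ^ (α / 2 - (i + 1 : ℕ)) + (2 * l) ^ (α / 2 - (i + 1 : ℕ)))) *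
      ((‖x - y‖ ^ ((n : ℝ) - α))⁻¹ * (l / 2 + ‖y‖ ^ 2) ^ (-((n + α) / 2))))
    hs ?_ ?_ ?_ ?_ ?_ ?_).2
  · filter_upwards [hs] with l' hl'
    exact (integrable_riesz_leibnizSum hα hαn i (hpos l' hl') x).1
  · exact integrable_riesz_leibnizSum hα hαn i hl x
  · exact (integrable_riesz_leibnizSum hα hαn (i + 1) hl x).1
  · refine ae_of_all _ fun y l' hl' => ?_
    rw [norm_mul, Real.norm_of_nonneg (by positivity : 0 ≤ (‖x - y‖ ^ ((n : ℝ) - α))⁻¹)]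
    have h0 := hpos l' hl'
    have h1 := abs_leibnizSum_le (α / 2) ((n + α) / 2) (i + 1) h0 (sq_nonneg ‖y‖)
    -- The exponent can have either sign, so the sum of both endpoint values serves as the bound
    -- uniform in `l'`.
    have h2 := rpow_le_add_rpow_of_mem_Icc (half_pos hl) ⟨hl'.1.le, hl'.2.le⟩
      (α / 2 - (i + 1 : ℕ))
    have h3 : (l' + ‖y‖ ^ 2) ^ (-((n + α) / 2)) ≤ (l / 2 + ‖y‖ ^ 2) ^ (-((n + α) / 2)) :=
      Real.rpow_le_rpow_of_nonpos (by positivity) (by linarith [hl'.1]) (by linarith)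
    calc _ ≤ (‖x - y‖ ^ ((n : ℝ) - α))⁻¹ *
          ((∑ j ∈ Finset.range (i + 1 + 1), |leibnizCoeff (α / 2) ((n + α) / 2) (i + 1) j|) *
          (((l / 2) ^ (α / 2 - (i + 1 : ℕ)) + (2 * l) ^ (α / 2 - (i + 1 : ℕ))) *
            (l / 2 + ‖y‖ ^ 2) ^ (-((n + α) / 2)))) := by
          refine mul_le_mul_of_nonneg_left (h1.trans ?_) (by positivity)
          gcongr
      _ = _ := by ring
  · exact (integrable_riesz_bracket hα hαn (half_pos hl) x).const_mul _
  · exact ae_of_all _ fun y l' hl' =>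
      (hasDerivAt_leibnizSum _ _ i (hpos l' hl') (sq_nonneg _)).const_mul _

/-- For `i = 0` the powers `l^(α/2)` and `l^(-α/2)` cancel. Higher orders follow by differentiating
both sides in `l` and uniqueness of the derivative. -/
lemma integral_riesz_leibnizSum (hα : 0 < α) (hαn : α < n) (i : ℕ) {l : ℝ} (hl : 0 < l)
    (x : EuclideanSpace ℝ (Fin n)) :
    ∫ y : EuclideanSpace ℝ (Fin n),
        (‖x - y‖ ^ ((n : ℝ) - α))⁻¹ * leibnizSum (α / 2) ((n + α) / 2) i l (‖y‖ ^ 2) =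
      rieszBracketConst n α * fallingFactorial (-((n - α) / 2)) i *
        (l + ‖x‖ ^ 2) ^ (-((n - α) / 2) - i) := by
  induction i generalizing l with
  | zero =>
    have h := lintegral_riesz_bracket hα hαn hl x
    rw [← ofReal_integral_eq_lintegral_ofReal (integrable_riesz_bracket hα hαn hl x)
      (ae_of_all _ fun y => by positivity)] at h
    have hGA := Real.Gamma_pos_of_pos (show 0 < (n + α) / 2 by positivity)
    have hGα := Real.Gamma_pos_of_pos (half_pos hα)
    have h := (ENNReal.ofReal_eq_ofReal_iff (integral_nonneg fun y => by positivity)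
      (by positivity)).1 h
    simp only [leibnizSum, leibnizCoeff, zero_add, Finset.range_one, Finset.sum_singleton,
      Nat.choose_self, Nat.cast_one, Nat.sub_self, fallingFactorial_zero, Nat.cast_zero, sub_zero,
      add_zero, one_mul, mul_one, mul_left_comm _ (l ^ (α / 2))]
    rw [integral_const_mul, h, rieszBracketConst, Real.rpow_neg hl.le]
    have : 0 < l ^ (α / 2) := by positivity
    field_simp
  | succ i ih =>
    have hlx : 0 < l + ‖x‖ ^ 2 := by positivity
    have h1 := hasDerivAt_integral_riesz_leibnizSum hα hαn i hl x
    have h2 : HasDerivAt (fun l => rieszBracketConst n α * fallingFactorial (-((n - α) / 2)) i *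
        (l + ‖x‖ ^ 2) ^ (-((n - α) / 2) - i))
        (rieszBracketConst n α * fallingFactorial (-((n - α) / 2)) i *
          (1 * (-((n - α) / 2) - i) * (l + ‖x‖ ^ 2) ^ (-((n - α) / 2) - i - 1))) l :=
      (((hasDerivAt_id l).add_const _).rpow_const (Or.inl hlx.ne')).const_mul _
    have h3 := h1.congr_of_eventuallyEq (f₁ := fun l => rieszBracketConst n α *
      fallingFactorial (-((n - α) / 2)) i * (l + ‖x‖ ^ 2) ^ (-((n - α) / 2) - i))
      ((eventually_gt_nhds hl).mono fun l' hl' => (ih hl').symm)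
    rw [h3.unique h2, fallingFactorial_succ]
    push_cast
    rw [show -((n - α) / 2) - (i + 1 : ℝ) = -((n - α) / 2) - i - 1 by ring]
    ring

lemma integral_riesz_scaledLeibnizSum (hα : 0 < α) (hαn : α < n) (i : ℕ) {t : ℝ} (ht : 0 < t)
    (x : EuclideanSpace ℝ (Fin n)) :
    ∫ y : EuclideanSpace ℝ (Fin n),
        (‖x - y‖ ^ ((n : ℝ) - α))⁻¹ * scaledLeibnizSum (α / 2) ((n + α) / 2) i t (‖y‖ ^ 2) =
      rieszBracketConst n α * fallingFactorial (-((n - α) / 2)) i *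
        (t ^ (2 * i - α) * (t ^ 2 + ‖x‖ ^ 2) ^ (-((n - α) / 2 + i))) := by
  simp only [scaledLeibnizSum_eq _ _ i ht, mul_left_comm _ (t ^ (2 * (i : ℝ) - 2 * (α / 2)))]
  rw [integral_const_mul, integral_riesz_leibnizSum hα hαn i (by positivity),
    mul_div_cancel₀ α two_ne_zero, neg_add']
  ring

end Riesz

/-! ### Fubini for Riesz potentials tested against decaying kernels -/

section Fubini

variable {n : ℕ} {α : ℝ} {𝕜 : Type*} [RCLike 𝕜]

lemma memLp_bracket_rpow {B : ℝ} {q : ℝ} (hq : 0 < q) (hB : (n : ℝ) < 2 * B * q) :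
    MemLp (fun z : EuclideanSpace ℝ (Fin n) => (1 + ‖z‖ ^ 2) ^ (-B)) (ENNReal.ofReal q) := by
  rw [← integrable_norm_rpow_iff (Measurable.aestronglyMeasurable (by fun_prop)) (by simpa using hq)
    ENNReal.ofReal_ne_top, ENNReal.toReal_ofReal hq.le]
  have h := integrable_rpow_neg_one_add_norm_sq (E := EuclideanSpace ℝ (Fin n)) (μ := volume)
    (r := 2 * B * q) (by simpa using hB)
  refine h.congr (ae_of_all _ fun z => ?_)
  simp only
  rw [Real.norm_of_nonneg (by positivity), ← Real.rpow_mul (by positivity)]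
  congr 1
  ring

/-- Hölder for `p > 1`; for `p = 1` the kernel is bounded by `1`, so no decay is required. -/
lemma integrable_bracket_smul {B : ℝ} (hB : 0 ≤ B) {p : ℝ≥0∞} (hp : 1 ≤ p) (hpt : p ≠ ∞)
    (hBp : 1 < p.toReal → (n : ℝ) < 2 * B * p.toReal.conjExponent)
    {f : EuclideanSpace ℝ (Fin n) → 𝕜} (hf : MemLp f p volume) (x : EuclideanSpace ℝ (Fin n)) :
    Integrable (fun z => ((1 + ‖x - z‖ ^ 2) ^ (-B) : ℝ) • f z) := by
  have hp1 : 1 ≤ p.toReal := by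
    rw [← ENNReal.toReal_one]; exact ENNReal.toReal_mono hpt hp
  have hmp := Measure.measurePreserving_sub_left
    (volume : Measure (EuclideanSpace ℝ (Fin n))) x
  rcases hp1.eq_or_lt with h1 | h1
  · have hp' : p = 1 := by
      rw [← ENNReal.ofReal_toReal hpt, ← h1, ENNReal.ofReal_one]
    subst hp'
    refine (memLp_one_iff_integrable.1 hf).norm.mono' (AEStronglyMeasurable.smul
      (Measurable.aestronglyMeasurable (by fun_prop)) hf.1) (ae_of_all _ fun z => ?_)
    rw [norm_smul, Real.norm_of_nonneg (by positivity)]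
    refine mul_le_of_le_one_left (norm_nonneg _) ?_
    exact Real.rpow_le_one_of_one_le_of_nonpos (by nlinarith [norm_nonneg (x - z)]) (by linarith)
  · have hc := Real.HolderConjugate.conjExponent h1
    have hc' : ENNReal.HolderConjugate (ENNReal.ofReal p.toReal.conjExponent) p := by
      have := hc.symm.ennrealOfReal
      rwa [ENNReal.ofReal_toReal hpt] at this
    have hg := (memLp_bracket_rpow hc.symm.pos (hBp h1)).comp_measurePreserving hmp
    exact memLp_one_iff_integrable.1 (hf.smul hg)

/-- The condition `p < n/α` says exactly that `(n-α) p' > n`, the integrability at infinity that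
Hölder needs. -/
lemma lt_mul_conjExponent {p : ℝ≥0∞} (hα : 0 < α) (hpα : p < ENNReal.ofReal (n / α))
    (h1 : 1 < p.toReal) : (n : ℝ) < 2 * ((n - α) / 2) * p.toReal.conjExponent := by
  have hpt : p ≠ ∞ := (hpα.trans ENNReal.ofReal_lt_top).ne
  have hpn : p.toReal * α < n := by
    rw [← lt_div_iff₀ hα]
    exact (ENNReal.lt_ofReal_iff_toReal_lt hpt).1 hpα
  rw [Real.conjExponent, ← mul_div_assoc, lt_div_iff₀ (by linarith)]
  nlinarith

lemma add_rpow_neg_le {l q B : ℝ} (hl : 0 < l) (hq : 0 ≤ q) (hB : 0 ≤ B) :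
    (l + q) ^ (-B) ≤ (min 1 l) ^ (-B) * (1 + q) ^ (-B) := by
  have hm : 0 < min 1 l := lt_min one_pos hl
  rw [← Real.mul_rpow hm.le (by positivity)]
  refine Real.rpow_le_rpow_of_nonpos (by positivity) ?_ (by linarith)
  nlinarith [min_le_left 1 l, min_le_right 1 l]

/-- The integrand of the double integral which expresses a Riesz potential tested against a
kernel `K`. -/
def rieszDouble (α : ℝ) (K : EuclideanSpace ℝ (Fin n) → ℝ)
    (f : EuclideanSpace ℝ (Fin n) → 𝕜) (x : EuclideanSpace ℝ (Fin n))
    (z : EuclideanSpace ℝ (Fin n) × EuclideanSpace ℝ (Fin n)) : 𝕜 :=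
  K (x - z.1) • rieszIntegrand α f z.1 z.2

/-- Integrate first in the variable of the potential: the explicit Riesz formula leaves `|f|`
against a multiple of `(1+|x-z|²)^(-(n-α)/2)`. -/
lemma integrable_rieszDouble {p : ℝ≥0∞} (hα : 0 < α) (hαn : α < n) (hp : 1 ≤ p)
    (hpα : p < ENNReal.ofReal (n / α)) {f : EuclideanSpace ℝ (Fin n) → 𝕜} (hf : MemLp f p volume)
    {K : EuclideanSpace ℝ (Fin n) → ℝ} (hK : Continuous K) {C l : ℝ} (hC : 0 ≤ C) (hl : 0 < l)
    (hKb : ∀ y, |K y| ≤ C * (l + ‖y‖ ^ 2) ^ (-((n + α) / 2))) (x : EuclideanSpace ℝ (Fin n)) :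
    Integrable (rieszDouble α K f x) := by
  have hmeas : AEStronglyMeasurable (rieszDouble α K f x) (volume.prod volume) :=
    (by fun_prop : Measurable fun z : EuclideanSpace ℝ (Fin n) × EuclideanSpace ℝ (Fin n) =>
        K (x - z.1)).aestronglyMeasurable.smul
      ((by fun_prop : Measurable fun z : EuclideanSpace ℝ (Fin n) × EuclideanSpace ℝ (Fin n) =>
        (‖z.1 - z.2‖ ^ ((n : ℝ) - α))⁻¹).aestronglyMeasurable.smul hf.1.comp_snd)
  refine ⟨hmeas, ?_⟩
  obtain ⟨D, hD⟩ : ∃ D, D = rieszBracketConst n α * l ^ (-(α / 2)) := ⟨_, rfl⟩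
  have hD0 : 0 ≤ D := by
    have := Real.Gamma_pos_of_pos (half_pos hα)
    have := Real.Gamma_pos_of_pos (show 0 < (n + α) / 2 by positivity)
    rw [hD, rieszBracketConst]; positivity
  have hB : 0 ≤ (n - α) / 2 := by linarith
  have hinner : ∀ z : EuclideanSpace ℝ (Fin n), ∫⁻ y, ‖rieszDouble α K f x (y, z)‖ₑ ≤
      ENNReal.ofReal (C * D * min 1 l ^ (-((n - α) / 2))) *
        ‖((1 + ‖x - z‖ ^ 2) ^ (-((n - α) / 2)) : ℝ) • f z‖ₑ := by
    intro z
    calc _ ≤ ∫⁻ y, ENNReal.ofReal (C * ‖f z‖) * ENNReal.ofReal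
          ((‖(x - z) - (x - y)‖ ^ ((n : ℝ) - α))⁻¹ * (l + ‖x - y‖ ^ 2) ^ (-((n + α) / 2))) := by
          refine lintegral_mono fun y => ?_
          rw [← ofReal_norm, ← ENNReal.ofReal_mul (by positivity), sub_sub_sub_cancel_left]
          refine ENNReal.ofReal_le_ofReal ?_
          simp only [rieszDouble, rieszIntegrand, norm_smul, Real.norm_eq_abs]
          rw [abs_of_nonneg (by positivity : 0 ≤ (‖y - z‖ ^ ((n : ℝ) - α))⁻¹)]
          have := mul_le_mul_of_nonneg_right (hKb (x - y))
            (by positivity : 0 ≤ (‖y - z‖ ^ ((n : ℝ) - α))⁻¹ * ‖f z‖)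
          refine this.trans_eq ?_
          ring
      _ = ENNReal.ofReal (C * ‖f z‖) * ENNReal.ofReal
          (D * (l + ‖x - z‖ ^ 2) ^ (-((n - α) / 2))) := by
          rw [lintegral_const_mul' _ _ ENNReal.ofReal_ne_top,
            lintegral_sub_left_eq_self (fun y : EuclideanSpace ℝ (Fin n) => ENNReal.ofReal
              ((‖(x - z) - y‖ ^ ((n : ℝ) - α))⁻¹ * (l + ‖y‖ ^ 2) ^ (-((n + α) / 2)))),
            lintegral_riesz_bracket hα hαn hl, hD, rieszBracketConst]
          ring_nf
      _ ≤ _ := by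
          rw [← ofReal_norm, ← ENNReal.ofReal_mul (by positivity),
            ← ENNReal.ofReal_mul (by positivity), norm_smul,
            Real.norm_of_nonneg (by positivity)]
          refine ENNReal.ofReal_le_ofReal ?_
          have := mul_le_mul_of_nonneg_left (add_rpow_neg_le hl (sq_nonneg ‖x - z‖) hB)
            (by positivity : 0 ≤ C * ‖f z‖ * D)
          calc _ = C * ‖f z‖ * D * (l + ‖x - z‖ ^ 2) ^ (-((n - α) / 2)) := by ring
            _ ≤ _ := this
            _ = _ := by ring
  rw [hasFiniteIntegral_iff_enorm]
  calc _ = ∫⁻ z, ∫⁻ y, ‖rieszDouble α K f x (y, z)‖ₑ := lintegral_prod_symm _ hmeas.enorm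
    _ ≤ _ := lintegral_mono hinner
    _ < ∞ := by
      rw [lintegral_const_mul' _ _ ENNReal.ofReal_ne_top]
      exact ENNReal.mul_lt_top ENNReal.ofReal_lt_top
        (integrable_bracket_smul hB hp (hpα.trans ENNReal.ofReal_lt_top).ne
          (lt_mul_conjExponent hα hpα) hf x).2

/-- Almost every section of the double integrand is integrable, and a strictly positive test kernel
can be divided out. -/
lemma ae_integrable_rieszIntegrand {p : ℝ≥0∞} (hα : 0 < α) (hαn : α < n) (hp : 1 ≤ p)
    (hpα : p < ENNReal.ofReal (n / α)) {f : EuclideanSpace ℝ (Fin n) → 𝕜}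
    (hf : MemLp f p volume) : ∀ᵐ x, Integrable (rieszIntegrand α f x) volume := by
  have h := integrable_rieszDouble hα hαn hp hpα hf
    (K := fun y => (1 + ‖y‖ ^ 2) ^ (-((n + α) / 2)))
    (contDiff_bracket_rpow (k := 0) _).continuous zero_le_one one_pos
    (fun y => by rw [one_mul, abs_of_nonneg (by positivity)]) 0
  filter_upwards [Integrable.prod_right_ae h] with y hy
  have hpos : (1 + ‖0 - y‖ ^ 2) ^ (-((n + α) / 2)) ≠ 0 := by positivity
  exact (integrable_smul_iff hpos _).1 hy

lemma integrable_smul_rieszPotential {p : ℝ≥0∞} (hα : 0 < α) (hαn : α < n) (hp : 1 ≤ p)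
    (hpα : p < ENNReal.ofReal (n / α)) {f : EuclideanSpace ℝ (Fin n) → 𝕜} (hf : MemLp f p volume)
    {K : EuclideanSpace ℝ (Fin n) → ℝ} (hK : Continuous K) {C l : ℝ} (hC : 0 ≤ C) (hl : 0 < l)
    (hKb : ∀ y, |K y| ≤ C * (l + ‖y‖ ^ 2) ^ (-((n + α) / 2))) (x : EuclideanSpace ℝ (Fin n)) :
    Integrable (fun y => K (x - y) • rieszPotential α f y) := by
  have h := (integrable_rieszDouble hα hαn hp hpα hf hK hC hl hKb x).integral_prod_left
  refine (h.smul (rieszGamma n α)⁻¹).congr (ae_of_all _ fun y => ?_)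
  simp only [rieszDouble, rieszPotential, integral_smul, Pi.smul_apply, smul_comm (K (x - y))]

lemma integral_smul_rieszPotential {p : ℝ≥0∞} (hα : 0 < α) (hαn : α < n) (hp : 1 ≤ p)
    (hpα : p < ENNReal.ofReal (n / α)) {f : EuclideanSpace ℝ (Fin n) → 𝕜} (hf : MemLp f p volume)
    {K : EuclideanSpace ℝ (Fin n) → ℝ} (hK : Continuous K) {C l : ℝ} (hC : 0 ≤ C) (hl : 0 < l)
    (hKb : ∀ y, |K y| ≤ C * (l + ‖y‖ ^ 2) ^ (-((n + α) / 2))) (x : EuclideanSpace ℝ (Fin n)) :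
    ∫ y, K (x - y) • rieszPotential α f y = (rieszGamma n α)⁻¹ •
      ∫ z, (∫ y, (‖(x - z) - y‖ ^ ((n : ℝ) - α))⁻¹ * K y) • f z := by
  have h := integrable_rieszDouble hα hαn hp hpα hf hK hC hl hKb x
  calc _ = (rieszGamma n α)⁻¹ • ∫ y, ∫ z, rieszDouble α K f x (y, z) := by
        rw [← integral_smul]
        refine integral_congr_ae (ae_of_all _ fun y => ?_)
        simp only [rieszDouble, rieszPotential, integral_smul, smul_comm (K (x - y))]
    _ = (rieszGamma n α)⁻¹ • ∫ z, ∫ y, rieszDouble α K f x (y, z) := by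
        rw [integral_integral_swap (f := fun y z => rieszDouble α K f x (y, z)) h]
    _ = _ := by
        congr 1
        refine integral_congr_ae (ae_of_all _ fun z => ?_)
        simp only
        rw [← integral_sub_left_eq_self
          (fun y => (‖(x - z) - y‖ ^ ((n : ℝ) - α))⁻¹ * K y) volume x, ← integral_smul_const]
        refine integral_congr_ae (ae_of_all _ fun y => ?_)
        simp only [rieszDouble, rieszIntegrand, smul_smul, sub_sub_sub_cancel_left]
        rw [mul_comm]

end Fubini

/-! ### Both inversion families as averages of `f` -/

section Representation

variable {n : ℕ} {α : ℝ} {𝕜 : Type*} [RCLike 𝕜]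

/-- The dilated kernel `t^(-n) (1 + |y / t|²)^(-b)`. -/
def bracketKernel (b t : ℝ) (y : EuclideanSpace ℝ (Fin n)) : ℝ :=
  t ^ (2 * b - n) * (t ^ 2 + ‖y‖ ^ 2) ^ (-b)

/-- The average of `f` against the dilated kernel `t^(-n) (1 + |y / t|²)^(-b)`. -/
def bracketMean (b : ℝ) (f : EuclideanSpace ℝ (Fin n) → 𝕜) (t : ℝ)
    (x : EuclideanSpace ℝ (Fin n)) : 𝕜 :=
  ∫ z, bracketKernel b t (x - z) • f z

lemma continuous_scaledLeibnizSum (a A : ℝ) (i : ℕ) {t : ℝ} (ht : 0 < t) :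
    Continuous (fun y : EuclideanSpace ℝ (Fin n) => scaledLeibnizSum a A i t (‖y‖ ^ 2)) := by
  simp only [scaledLeibnizSum_eq a A i ht]
  exact continuous_const.mul (continuous_leibnizSum a A i (by positivity))

lemma abs_const_mul_scaledLeibnizSum_le (a A c : ℝ) (i : ℕ) {t : ℝ} (ht : 0 < t)
    (y : EuclideanSpace ℝ (Fin n)) :
    |c * scaledLeibnizSum a A i t (‖y‖ ^ 2)| ≤
      |c| * (∑ j ∈ Finset.range (i + 1), |leibnizCoeff a A i j|) *
        (t ^ 2 + ‖y‖ ^ 2) ^ (-A) := by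
  rw [abs_mul, mul_assoc]
  exact mul_le_mul_of_nonneg_left (abs_scaledLeibnizSum_le a A i ht (sq_nonneg _)) (abs_nonneg _)

variable {p : ℝ≥0∞} {f : EuclideanSpace ℝ (Fin n) → 𝕜}

lemma integral_scaledLeibnizSum_smul_rieszPotential (hα : 0 < α) (hαn : α < n) (hp : 1 ≤ p)
    (hpα : p < ENNReal.ofReal (n / α)) (hf : MemLp f p volume) (c : ℝ) (i : ℕ) {t : ℝ}
    (ht : 0 < t) (x : EuclideanSpace ℝ (Fin n)) :
    ∫ y, (c * scaledLeibnizSum (α / 2) ((n + α) / 2) i t (‖x - y‖ ^ 2)) • rieszPotential α f y =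
      ((rieszGamma n α)⁻¹ * c * rieszBracketConst n α * fallingFactorial (-((n - α) / 2)) i) •
        bracketMean ((n - α) / 2 + i) f t x := by
  rw [integral_smul_rieszPotential (K := fun y => c * scaledLeibnizSum (α / 2) ((n + α) / 2) i t
    (‖y‖ ^ 2)) hα hαn hp hpα hf (continuous_const.mul (continuous_scaledLeibnizSum _ _ i ht))
    (by positivity) (by positivity : 0 < t ^ 2)
    (fun y => abs_const_mul_scaledLeibnizSum_le _ _ c i ht y)]
  simp only [mul_left_comm _ c, integral_const_mul, integral_riesz_scaledLeibnizSum hα hαn i ht]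
  rw [bracketMean, mul_assoc, mul_assoc, mul_smul, ← integral_smul (c * _)]
  congr 1
  refine integral_congr_ae (ae_of_all _ fun z => ?_)
  simp only [smul_smul, bracketKernel]
  -- The factor `t^(2i-α)` of the scaled sum is exactly the normalization that preserves the mass of
  -- the kernel with `b = (n-α)/2 + i`.
  rw [show 2 * (((n : ℝ) - α) / 2 + i) - n = 2 * i - α by ring]
  ring_nf

lemma convDefined_recon (hα : 0 < α) (hαn : α < n) (hp : 1 ≤ p)
    (hpα : p < ENNReal.ofReal (n / α)) (hf : MemLp f p volume) (m : ℕ) {t : ℝ} (ht : 0 < t) :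
    ConvDefined (rieszPotential α f) (fun y => t ^ (-α) * dilate (recon n m α) t y) := by
  intro x
  simp only [rpow_neg_mul_dilate_recon m α ht]
  exact integrable_smul_rieszPotential (K := fun y => reconConst n m α *
    scaledLeibnizSum (α / 2) ((n + α) / 2) m t (‖y‖ ^ 2)) hα hαn hp hpα hf
    (continuous_const.mul (continuous_scaledLeibnizSum _ _ m ht))
    (by positivity) (by positivity : 0 < t ^ 2)
    (fun y => abs_const_mul_scaledLeibnizSum_le _ _ _ m ht y) x

lemma convDefined_reconTilde (hα : 0 < α) (hαn : α < n) (hp : 1 ≤ p)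
    (hpα : p < ENNReal.ofReal (n / α)) (hf : MemLp f p volume) (m : ℕ) {t : ℝ} (ht : 0 < t) :
    ConvDefined (rieszPotential α f) (dilate (reconTilde n m α) t) := by
  intro x
  obtain ⟨C, hC, hb⟩ := exists_abs_dilate_reconTilde_le n m α
  have hc : (t ^ (1 + α))⁻¹ ≠ 0 := by positivity
  have hK : Continuous (fun y : EuclideanSpace ℝ (Fin n) =>
      (t ^ (1 + α))⁻¹ * dilate (reconTilde n m α) t y) := by
    rw [← continuousOn_univ]
    exact (continuousOn_dilate_reconTilde m α).comp (f := fun y => (t, y)) (by fun_prop)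
      fun y _ => ⟨ht, mem_univ _⟩
  have h := integrable_smul_rieszPotential hα hαn hp hpα hf hK
    (C := C * (t * (t ^ 2)⁻¹)) (by positivity) (by positivity : 0 < t ^ 2) (fun y => ?_) x
  · simp only [mul_smul] at h
    exact (integrable_smul_iff hc _).1 h
  · refine (hb t ht y).trans ?_
    rw [mul_assoc, mul_assoc]
    have hq := pow_mul_rpow_sub_le (by positivity : 0 < t ^ 2) (sq_nonneg ‖y‖) (-((n + α) / 2)) 1
    rw [pow_one, Nat.cast_one] at hq
    gcongr
    rw [le_inv_mul_iff₀ (by positivity)]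
    exact hq

lemma approxInv_eq (hα : 0 < α) (hαn : α < n) (hp : 1 ≤ p)
    (hpα : p < ENNReal.ofReal (n / α)) (hf : MemLp f p volume) (m : ℕ) {t : ℝ} (ht : 0 < t)
    (x : EuclideanSpace ℝ (Fin n)) :
    approxInv m α f t x = ((rieszGamma n α)⁻¹ * reconConst n m α * rieszBracketConst n α *
      fallingFactorial (-((n - α) / 2)) m) • bracketMean ((n - α) / 2 + m) f t x := by
  rw [← integral_scaledLeibnizSum_smul_rieszPotential hα hαn hp hpα hf _ m ht]
  simp only [← rpow_neg_mul_dilate_recon m α ht]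
  rfl

lemma aestronglyMeasurable_rieszPotential (hα : 0 < α) (hαn : α < n) (hp : 1 ≤ p)
    (hpα : p < ENNReal.ofReal (n / α)) (hf : MemLp f p volume) :
    AEStronglyMeasurable (rieszPotential α f) volume := by
  have h := (integrable_smul_rieszPotential hα hαn hp hpα hf
    (K := fun y => (1 + ‖y‖ ^ 2) ^ (-((n + α) / 2)))
    (contDiff_bracket_rpow (k := 0) _).continuous zero_le_one one_pos
    (fun y => by rw [one_mul, abs_of_nonneg (by positivity)]) 0).1
  have hk : Measurable (fun y : EuclideanSpace ℝ (Fin n) =>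
    ((1 + ‖0 - y‖ ^ 2) ^ (-((n + α) / 2)))⁻¹) := by fun_prop
  refine (hk.aestronglyMeasurable.smul h).congr (ae_of_all _ fun y => ?_)
  have h0 : (1 + ‖0 - y‖ ^ 2) ^ (-((n + α) / 2)) ≠ 0 := by positivity
  exact inv_smul_smul₀ h0 _

/-- Integrating the bound on `w̃_t` over `t > ε` gives a multiple of `(ε²+|x-y|²)^(-(n+α)/2)`,
already known to be integrable against the potential. -/
lemma integrable_wavelet (hα : 0 < α) (hαn : α < n) (hp : 1 ≤ p)
    (hpα : p < ENNReal.ofReal (n / α)) (hf : MemLp f p volume) (m : ℕ) {ε : ℝ} (hε : 0 < ε)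
    (x : EuclideanSpace ℝ (Fin n)) :
    Integrable (fun z : ℝ × EuclideanSpace ℝ (Fin n) =>
      ((z.1 ^ (1 + α))⁻¹ * dilate (reconTilde n m α) z.1 (x - z.2)) • rieszPotential α f z.2)
      ((volume.restrict (Ioi ε)).prod volume) := by
  obtain ⟨C, hC, hb⟩ := exists_abs_dilate_reconTilde_le n m α
  have hA : 0 < (n + α) / 2 := by positivity
  have hmeas : AEStronglyMeasurable (fun z : ℝ × EuclideanSpace ℝ (Fin n) =>
      ((z.1 ^ (1 + α))⁻¹ * dilate (reconTilde n m α) z.1 (x - z.2)) • rieszPotential α f z.2)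
      ((volume.restrict (Ioi ε)).prod volume) := by
    refine AEStronglyMeasurable.smul ?_
      (aestronglyMeasurable_rieszPotential hα hαn hp hpα hf).comp_snd
    rw [← Measure.restrict_univ (μ := (volume : Measure (EuclideanSpace ℝ (Fin n)))),
      Measure.prod_restrict]
    refine ContinuousOn.aestronglyMeasurable ?_ (measurableSet_Ioi.prod MeasurableSet.univ)
    exact (continuousOn_dilate_reconTilde m α).comp
      (f := fun z : ℝ × EuclideanSpace ℝ (Fin n) => (z.1, x - z.2)) (by fun_prop)
      fun z hz => ⟨hε.trans hz.1, mem_univ _⟩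
  refine ⟨hmeas, ?_⟩
  have hK := (integrable_smul_rieszPotential hα hαn hp hpα hf
    (K := fun y => C * (2 * ((n + α) / 2))⁻¹ * (ε ^ 2 + ‖y‖ ^ 2) ^ (-((n + α) / 2)))
    (continuous_const.mul (Continuous.rpow_const (by fun_prop)
      fun y => Or.inl (by positivity)))
    (by positivity) (by positivity : 0 < ε ^ 2)
    (fun y => (abs_of_nonneg (by positivity)).le) x).2
  rw [hasFiniteIntegral_iff_enorm] at hK ⊢
  rw [lintegral_prod_symm _ hmeas.enorm]
  refine lt_of_le_of_lt (lintegral_mono fun y => ?_) hK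
  calc _ ≤ ∫⁻ t in Ioi ε, ENNReal.ofReal (C * ‖rieszPotential α f y‖) *
        ENNReal.ofReal (t * (t ^ 2 + ‖x - y‖ ^ 2) ^ (-((n + α) / 2) - 1)) := by
        refine setLIntegral_mono_ae' measurableSet_Ioi (ae_of_all _ fun t ht => ?_)
        rw [← ENNReal.ofReal_mul (by positivity), ← ofReal_norm, norm_smul]
        refine ENNReal.ofReal_le_ofReal ?_
        have := mul_le_mul_of_nonneg_right (hb t (hε.trans ht) (x - y))
          (norm_nonneg (rieszPotential α f y))
        refine this.trans_eq ?_
        ring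
    _ = _ := by
        rw [lintegral_const_mul' _ _ ENNReal.ofReal_ne_top,
          lintegral_mul_sq_add_rpow hA (sq_nonneg _) hε, ← ENNReal.ofReal_mul (by positivity),
          ← ofReal_norm, norm_smul, Real.norm_of_nonneg (by positivity)]
        ring_nf

lemma waveletIntegrand_eq (m : ℕ) (x : EuclideanSpace ℝ (Fin n)) (t : ℝ) :
    waveletIntegrand m α f x t = ∫ y, ((t ^ (1 + α))⁻¹ *
      dilate (reconTilde n m α) t (x - y)) • rieszPotential α f y := by
  simp only [mul_smul, integral_smul]
  rfl

lemma integrableOn_waveletIntegrand (hα : 0 < α) (hαn : α < n) (hp : 1 ≤ p)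
    (hpα : p < ENNReal.ofReal (n / α)) (hf : MemLp f p volume) (m : ℕ) {ε : ℝ} (hε : 0 < ε)
    (x : EuclideanSpace ℝ (Fin n)) :
    IntegrableOn (waveletIntegrand m α f x) (Ioi ε) volume := by
  refine (integrable_wavelet hα hαn hp hpα hf m hε x).integral_prod_left.congr
    (ae_of_all _ fun t => ?_)
  exact (waveletIntegrand_eq m x t).symm

lemma waveletInv_eq (hα : 0 < α) (hαn : α < n) (hp : 1 ≤ p)
    (hpα : p < ENNReal.ofReal (n / α)) (hf : MemLp f p volume) (m : ℕ) {ε : ℝ} (hε : 0 < ε)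
    (x : EuclideanSpace ℝ (Fin n)) :
    waveletInv m α f ε x = ((rieszGamma n α)⁻¹ * -(2 * reconConst n m α) *
      rieszBracketConst n α * fallingFactorial (-((n - α) / 2)) (m + 1)) •
        bracketMean ((n - α) / 2 + (m + 1 : ℕ)) f ε x := by
  rw [← integral_scaledLeibnizSum_smul_rieszPotential hα hαn hp hpα hf _ (m + 1) hε]
  simp only [waveletInv, waveletIntegrand_eq]
  rw [integral_integral_swap (f := fun t y => ((t ^ (1 + α))⁻¹ *
      dilate (reconTilde n m α) t (x - y)) • rieszPotential α f y)
    (integrable_wavelet hα hαn hp hpα hf m hε x)]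
  simp only [integral_smul_const, integral_dilate_reconTilde m hα hε]

end Representation

/-! ### Identification of the constants -/

/-- At a pole, `-s = -i` with `i < m`: the falling factorial vanishes, matching `1/Γ = 0` on the
right. This covers the cases where `γ_n(2m-α) = 0`. -/
lemma fallingFactorial_div_Gamma (s : ℝ) (m : ℕ) (hs : 0 < -s + m) :
    (-1) ^ m * fallingFactorial s m / Real.Gamma (-s + m) = (Real.Gamma (-s))⁻¹ := by
  by_cases h : ∀ i < m, -s + i ≠ 0
  · have hG := Gamma_eq_fallingFactorial_mul (-s) m h
    have hpos := Real.Gamma_pos_of_pos hs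
    rw [neg_neg] at hG
    rw [hG] at hpos ⊢
    have h1 : fallingFactorial s m ≠ 0 := fun h0 => by simp [h0] at hpos
    have h2 : Real.Gamma (-s) ≠ 0 := fun h0 => by simp [h0] at hpos
    field_simp
  · push Not at h
    obtain ⟨i, hi, h0⟩ := h
    have h1 : fallingFactorial s m = 0 :=
      Finset.prod_eq_zero (Finset.mem_range.2 hi) (by linarith)
    rw [h1, show -s = -(i : ℝ) by linarith, Real.Gamma_neg_nat_eq_zero]
    simp

lemma approx_const_eq {n m : ℕ} {α : ℝ} (hα : 0 < α) (hαn : α < n) :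
    (rieszGamma n α)⁻¹ * reconConst n m α * rieszBracketConst n α *
      fallingFactorial (-((n - α) / 2)) m * bracketMass n ((n - α) / 2 + m) =
      rieszGamma n (2 * m - α) := by
  have hB : 0 < (n - α) / 2 := by linarith
  have hA : 0 < (n + α) / 2 := by positivity
  have hs : -((m : ℝ) - (n + α) / 2) + m = (n + α) / 2 := by ring
  have hF := fallingFactorial_div_Gamma ((m : ℝ) - (n + α) / 2) m (by rw [hs]; exact hA)
  rw [hs] at hF
  rw [bracketMass, Gamma_eq_fallingFactorial_mul _ m (fun i _ => by positivity)]
  have hGB := Real.Gamma_pos_of_pos hB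
  have hGA := Real.Gamma_pos_of_pos hA
  have hGα := Real.Gamma_pos_of_pos (half_pos hα)
  have hff : fallingFactorial (-((n - α) / 2)) m ≠ 0 :=
    Finset.prod_ne_zero_iff.2 fun i _ => by
      have : (0 : ℝ) ≤ i := Nat.cast_nonneg i
      linarith
  have h2 : (2 : ℝ) ^ (2 * m - α) = 4 ^ m / 2 ^ α := by
    rw [Real.rpow_sub two_pos, Real.rpow_mul two_pos.le, Real.rpow_natCast]
    norm_num
  rw [rieszGamma, rieszGamma, rieszBracketConst, reconConst, h2,
    show ((n : ℝ) - α) / 2 + m - n / 2 = (2 * m - α) / 2 by ring,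
    show ((n : ℝ) - (2 * m - α)) / 2 = -(m - (n + α) / 2) by ring, div_eq_mul_inv _
      (Real.Gamma (-(m - (n + α) / 2))), ← hF]
  have h1 : ((-1 : ℝ) ^ m) * (-1) ^ m = 1 := by rw [← mul_pow]; simp
  have h1' : ((-1 : ℝ) ^ m) ≠ 0 := by positivity
  generalize fallingFactorial ((m : ℝ) - (n + α) / 2) m = F
  generalize Real.Gamma ((2 * m - α) / 2) = G
  field_simp
  linear_combination (-(F * G)) * h1

/-- Relative to order `m`, with `v = (n-α)/2 + m`, the constant gains `-2` from the scale integral,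
`-v` from the falling factorial, and `((2m-α)/2) / v` from the mass; the product is `2m-α`. -/
lemma wavelet_const_eq {n m : ℕ} {α : ℝ} (hα : 0 < α) (hαn : α < n) (hm : α < 2 * m) :
    (rieszGamma n α)⁻¹ * -(2 * reconConst n m α) * rieszBracketConst n α *
      fallingFactorial (-((n - α) / 2)) (m + 1) * bracketMass n ((n - α) / 2 + (m + 1 : ℕ)) =
      (2 * m - α) * rieszGamma n (2 * m - α) := by
  have hB : 0 < (n - α) / 2 := by linarith
  have hBm : 0 < (n - α) / 2 + m := by positivity
  have hβ : 0 < (2 * m - α) / 2 := by linarith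
  rw [← approx_const_eq hα hαn, bracketMass, bracketMass, fallingFactorial_succ, Nat.cast_succ, ← add_assoc,
    Real.Gamma_add_one hBm.ne',
    show ((n : ℝ) - α) / 2 + m + 1 - n / 2 = (2 * m - α) / 2 + 1 by ring,
    Real.Gamma_add_one hβ.ne', show ((n : ℝ) - α) / 2 + m - n / 2 = (2 * m - α) / 2 by ring]
  have := Real.Gamma_pos_of_pos hBm
  have hBm' := hBm.ne'
  rw [show -(((n : ℝ) - α) / 2) - m = -((n - α) / 2 + m) by ring]
  generalize ((n : ℝ) - α) / 2 + m = v at *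
  field_simp

/-! ### The kernel as a superposition of balls -/

section ApproximateIdentity

variable {n : ℕ} {b : ℝ} {𝕜 : Type*} [RCLike 𝕜]

lemma bracketKernel_nonneg {t : ℝ} (ht : 0 < t) (y : EuclideanSpace ℝ (Fin n)) :
    0 ≤ bracketKernel b t y := by
  unfold bracketKernel; positivity

lemma measurable_bracketKernel (t : ℝ) :
    Measurable (bracketKernel b t : EuclideanSpace ℝ (Fin n) → ℝ) := by
  unfold bracketKernel; fun_prop

lemma bracketMass_pos (hb : (n : ℝ) / 2 < b) : 0 < bracketMass n b := by
  have := Real.Gamma_pos_of_pos (sub_pos.2 hb)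
  have := Real.Gamma_pos_of_pos (lt_of_le_of_lt (by positivity) hb)
  unfold bracketMass; positivity

lemma lintegral_bracketKernel (hb : (n : ℝ) / 2 < b) {t : ℝ} (ht : 0 < t) :
    ∫⁻ y : EuclideanSpace ℝ (Fin n), ENNReal.ofReal (bracketKernel b t y) =
      ENNReal.ofReal (bracketMass n b) := by
  simp only [bracketKernel, ENNReal.ofReal_mul (show 0 ≤ t ^ (2 * b - n) by positivity)]
  rw [lintegral_const_mul' _ _ ENNReal.ofReal_ne_top, lintegral_bracket_rpow hb (by positivity),
    ← ENNReal.ofReal_mul (by positivity), mul_left_comm, ← Real.rpow_natCast t 2,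
    ← Real.rpow_mul ht.le, ← Real.rpow_add ht,
    show 2 * b - n + ((2 : ℕ) : ℝ) * -(b - n / 2) = 0 by push_cast; ring, Real.rpow_zero, mul_one]

lemma lintegral_bracketKernel_sub (hb : (n : ℝ) / 2 < b) {t : ℝ} (ht : 0 < t)
    (x : EuclideanSpace ℝ (Fin n)) :
    ∫⁻ z : EuclideanSpace ℝ (Fin n), ENNReal.ofReal (bracketKernel b t (x - z)) =
      ENNReal.ofReal (bracketMass n b) := by
  rw [← lintegral_bracketKernel hb ht]
  exact lintegral_sub_left_eq_self
    (fun z : EuclideanSpace ℝ (Fin n) => ENNReal.ofReal (bracketKernel b t z)) x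

lemma integrable_bracketKernel_sub (hb : (n : ℝ) / 2 < b) {t : ℝ} (ht : 0 < t)
    (x : EuclideanSpace ℝ (Fin n)) : Integrable (fun z => bracketKernel b t (x - z)) := by
  refine ⟨((measurable_bracketKernel t).comp (measurable_const.sub measurable_id)
    ).aestronglyMeasurable, ?_⟩
  rw [hasFiniteIntegral_iff_ofReal (ae_of_all _ fun z => bracketKernel_nonneg ht _),
    lintegral_bracketKernel_sub hb ht]
  exact ENNReal.ofReal_lt_top

lemma integral_bracketKernel_sub (hb : (n : ℝ) / 2 < b) {t : ℝ} (ht : 0 < t)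
    (x : EuclideanSpace ℝ (Fin n)) : ∫ z, bracketKernel b t (x - z) = bracketMass n b := by
  have h := lintegral_bracketKernel_sub hb ht x
  have h0 : ∀ z, 0 ≤ bracketKernel b t (x - z) := fun z => bracketKernel_nonneg ht _
  rw [← ofReal_integral_eq_lintegral_ofReal (integrable_bracketKernel_sub hb ht x)
    (ae_of_all _ h0)] at h
  exact (ENNReal.ofReal_eq_ofReal_iff (integral_nonneg h0) (bracketMass_pos hb).le).1 h

/-- The density of `bracketKernel b t` in its representation as a superposition of balls. -/
def ballWeight (n : ℕ) (b t ρ : ℝ) : ℝ≥0∞ :=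
  ENNReal.ofReal (2 * b * t ^ (2 * b - n)) * ENNReal.ofReal (ρ * (ρ ^ 2 + t ^ 2) ^ (-b - 1))

lemma measurable_ballWeight (t : ℝ) : Measurable (ballWeight n b t) := by
  unfold ballWeight; fun_prop

lemma lintegral_ballWeight (hb : 0 < b) {t : ℝ} (ht : 0 < t) {y : EuclideanSpace ℝ (Fin n)}
    (hy : y ≠ 0) :
    ∫⁻ ρ in Ioi ‖y‖, ballWeight n b t ρ = ENNReal.ofReal (bracketKernel b t y) := by
  simp only [ballWeight]
  rw [lintegral_const_mul' _ _ ENNReal.ofReal_ne_top,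
    lintegral_mul_sq_add_rpow hb (sq_nonneg t) (norm_pos_iff.2 hy),
    ← ENNReal.ofReal_mul (by positivity), bracketKernel, add_comm (t ^ 2)]
  congr 1
  field_simp

/-- The kernel is radially decreasing, so its value at `x - z` is the weight of all radii above `|x
- z|`; Tonelli then exchanges radius and space. -/
lemma lintegral_bracketKernel_mul (hn : n ≠ 0) (hb : 0 < b) {t : ℝ} (ht : 0 < t)
    (x : EuclideanSpace ℝ (Fin n)) {φ : EuclideanSpace ℝ (Fin n) → ℝ≥0∞} (hφ : AEMeasurable φ) :
    ∫⁻ z, ENNReal.ofReal (bracketKernel b t (x - z)) * φ z =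
      ∫⁻ ρ, ballWeight n b t ρ * ∫⁻ z in Metric.ball x ρ, φ z := by
  let S : Set (EuclideanSpace ℝ (Fin n) × ℝ) := {q | ‖x - q.1‖ < q.2}
  have hS : MeasurableSet S := measurableSet_lt (by fun_prop) (by fun_prop)
  have hw := measurable_ballWeight (n := n) (b := b) t
  have hball : ∀ z ρ, (z, ρ) ∈ S ↔ z ∈ Metric.ball x ρ := fun z ρ => by
    simp [S, Metric.mem_ball, dist_comm z x, dist_eq_norm]
  calc _ = ∫⁻ z, ∫⁻ ρ, S.indicator (fun q => ballWeight n b t q.2) (z, ρ) * φ z := by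
        refine lintegral_congr_ae ((ae_ne_volume hn x).mono fun z hz => ?_)
        have e : (fun ρ => S.indicator (fun q => ballWeight n b t q.2) (z, ρ)) =
            (Ioi ‖x - z‖).indicator (ballWeight n b t) := by
          ext ρ; simp [S, indicator_apply]
        have hm : Measurable
            (fun ρ => S.indicator (fun q => ballWeight n b t q.2) (z, ρ)) := by
          rw [e]; exact hw.indicator measurableSet_Ioi
        simp only
        rw [lintegral_mul_const _ hm, e, lintegral_indicator measurableSet_Ioi,
          lintegral_ballWeight hb ht (sub_ne_zero.2 hz.symm)]
    _ = ∫⁻ ρ, ∫⁻ z, S.indicator (fun q => ballWeight n b t q.2) (z, ρ) * φ z :=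
        lintegral_lintegral_swap
          (((hw.comp measurable_snd).indicator hS).aemeasurable.mul hφ.comp_fst)
    _ = _ := by
        refine lintegral_congr fun ρ => ?_
        have e : ∀ z, S.indicator (fun q => ballWeight n b t q.2) (z, ρ) * φ z =
            ballWeight n b t ρ * (Metric.ball x ρ).indicator φ z := by
          intro z
          by_cases h : z ∈ Metric.ball x ρ
          · rw [indicator_of_mem h, indicator_of_mem ((hball z ρ).2 h)]
          · rw [indicator_of_notMem h, indicator_of_notMem (fun h' => h ((hball z ρ).1 h'))]
            simp
        simp only [e]
        rw [lintegral_const_mul' _ _ (by simp [ballWeight, ENNReal.mul_eq_top]),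
          lintegral_indicator Metric.isOpen_ball.measurableSet]

/-- An upper bound for the mass of `bracketKernel b t` carried by the balls of radius `> δ`. -/
def kernelTail (n : ℕ) (b δ t : ℝ) : ℝ≥0∞ :=
  ENNReal.ofReal (2 * b * t ^ (2 * b - n)) *
    ((∫⁻ ρ in Ioi δ, ENNReal.ofReal (ρ ^ ((n : ℝ) - 1 - 2 * b))) *
      volume (Metric.ball (0 : EuclideanSpace ℝ (Fin n)) 1))

lemma lintegral_rpow_mul_volume_ball_ne_top (hb : (n : ℝ) / 2 < b) {δ : ℝ} (hδ : 0 < δ) :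
    (∫⁻ ρ in Ioi δ, ENNReal.ofReal (ρ ^ ((n : ℝ) - 1 - 2 * b))) *
      volume (Metric.ball (0 : EuclideanSpace ℝ (Fin n)) 1) ≠ ∞ := by
  refine ENNReal.mul_ne_top ?_ measure_ball_lt_top.ne
  have h := integrableOn_Ioi_rpow_of_lt (a := (n : ℝ) - 1 - 2 * b) (by linarith) hδ
  exact ((hasFiniteIntegral_iff_ofReal ((ae_restrict_iff' measurableSet_Ioi).2
    (ae_of_all _ fun ρ hρ => Real.rpow_nonneg (hδ.trans hρ).le _))).1 h.2).ne

lemma kernelTail_ne_top (hb : (n : ℝ) / 2 < b) {δ : ℝ} (hδ : 0 < δ) (t : ℝ) :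
    kernelTail n b δ t ≠ ∞ :=
  ENNReal.mul_ne_top ENNReal.ofReal_ne_top (lintegral_rpow_mul_volume_ball_ne_top hb hδ)

lemma tendsto_kernelTail (hb : (n : ℝ) / 2 < b) {δ : ℝ} (hδ : 0 < δ) :
    Tendsto (kernelTail n b δ) (𝓝[>] 0) (𝓝 0) := by
  have hpos : 0 < 2 * b - n := by linarith
  have h1 : Tendsto (fun t : ℝ => 2 * b * t ^ (2 * b - n)) (𝓝[>] 0) (𝓝 0) := by
    have h := ((Real.continuousAt_rpow_const 0 (2 * b - n) (Or.inr hpos.le)).tendsto.const_mul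
      (2 * b)).mono_left (nhdsWithin_le_nhds (s := Ioi 0))
    rwa [Real.zero_rpow hpos.ne', mul_zero] at h
  have h2 := ENNReal.Tendsto.mul_const (ENNReal.tendsto_ofReal h1)
    (Or.inr (lintegral_rpow_mul_volume_ball_ne_top (n := n) hb hδ))
  rwa [ENNReal.ofReal_zero, zero_mul] at h2

/-- Dropping `t²` bounds the integrand by `ρ^(n-1-2b)` times the volume of the unit ball and the
prefactor. The power is integrable at infinity when `2b > n`, and smallness comes from `t^(2b-n)`.
-/
lemma setLIntegral_ballWeight_mul_volume_le (hb : 0 < b) {δ t : ℝ} (hδ : 0 < δ)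
    (x : EuclideanSpace ℝ (Fin n)) :
    ∫⁻ ρ in Ioi δ, ballWeight n b t ρ * volume (Metric.ball x ρ) ≤ kernelTail n b δ t := by
  rw [kernelTail, ← lintegral_mul_const' _ _ measure_ball_lt_top.ne,
    ← lintegral_const_mul' _ _ ENNReal.ofReal_ne_top]
  refine setLIntegral_mono' measurableSet_Ioi fun ρ hρ => ?_
  have hρ0 : 0 < ρ := hδ.trans hρ
  rw [Measure.addHaar_ball_of_pos _ _ hρ0, finrank_euclideanSpace_fin, ballWeight, mul_assoc,
    ← mul_assoc (ENNReal.ofReal (ρ * _))]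
  gcongr
  rw [← ENNReal.ofReal_mul (by positivity)]
  refine ENNReal.ofReal_le_ofReal ?_
  have h : (ρ ^ 2 + t ^ 2) ^ (-b - 1) ≤ (ρ ^ 2) ^ (-b - 1) :=
    Real.rpow_le_rpow_of_nonpos (by positivity) (by nlinarith [sq_nonneg t]) (by linarith)
  calc _ ≤ ρ * (ρ ^ 2) ^ (-b - 1) * ρ ^ n := by gcongr
    _ = _ := by
      rw [← Real.rpow_natCast ρ 2, ← Real.rpow_mul hρ0.le, ← Real.rpow_natCast ρ n,
        ← Real.rpow_one_add' hρ0.le (by push_cast; linarith), ← Real.rpow_add hρ0]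
      congr 1
      push_cast; ring

/-- Split the superposition at radius `δ`: small balls cost at most `η` times the full mass, large
ones at most `M` times the tail. -/
lemma lintegral_bracketKernel_mul_le (hn : n ≠ 0) (hb : (n : ℝ) / 2 < b) {t δ : ℝ} (ht : 0 < t)
    (hδ : 0 < δ) (x : EuclideanSpace ℝ (Fin n)) {φ : EuclideanSpace ℝ (Fin n) → ℝ≥0∞}
    (hφ : AEMeasurable φ) {η M : ℝ≥0∞} (hM : M ≠ ∞)
    (hsmall : ∀ ρ, 0 < ρ → ρ ≤ δ → ∫⁻ z in Metric.ball x ρ, φ z ≤ η * volume (Metric.ball x ρ))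
    (hlarge : ∀ ρ, δ < ρ → ∫⁻ z in Metric.ball x ρ, φ z ≤ M * volume (Metric.ball x ρ)) :
    ∫⁻ z, ENNReal.ofReal (bracketKernel b t (x - z)) * φ z ≤
      η * ENNReal.ofReal (bracketMass n b) + M * kernelTail n b δ t := by
  have hb0 : 0 < b := lt_of_le_of_lt (by positivity) hb
  have hvol : Measurable fun ρ => volume (Metric.ball x ρ) :=
    Monotone.measurable fun r s h => measure_mono (Metric.ball_subset_ball h)
  have hw := measurable_ballWeight (n := n) (b := b) t
  rw [lintegral_bracketKernel_mul hn hb0 ht x hφ]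
  calc _ ≤ ∫⁻ ρ, (η * (ballWeight n b t ρ * volume (Metric.ball x ρ)) +
        (Ioi δ).indicator (fun ρ => M * (ballWeight n b t ρ * volume (Metric.ball x ρ))) ρ) := by
        refine lintegral_mono fun ρ => ?_
        simp only
        rcases le_or_gt ρ 0 with h0 | h0
        · simp [Metric.ball_eq_empty.2 h0]
        rcases le_or_gt ρ δ with h1 | h1
        · refine le_add_right ?_
          rw [mul_left_comm]
          gcongr
          exact hsmall ρ h0 h1
        · refine le_add_left ?_
          rw [indicator_of_mem (mem_Ioi.2 h1), mul_left_comm]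
          gcongr
          exact hlarge ρ h1
    _ ≤ _ := by
        rw [lintegral_add_left (by fun_prop), lintegral_const_mul _ (by fun_prop),
          lintegral_indicator measurableSet_Ioi, lintegral_const_mul' _ _ hM]
        gcongr
        -- The superposition formula for the constant function `1` identifies the total weight with
        -- the mass of the kernel.
        · have h1 := lintegral_bracketKernel_mul hn hb0 ht x
            (φ := fun _ => 1) aemeasurable_const
          simp only [mul_one, setLIntegral_one] at h1
          rw [← h1, lintegral_bracketKernel_sub hb ht]
        · exact setLIntegral_ballWeight_mul_volume_le hb0 hδ x

/-- Choose `η` small first; it fixes `δ` and `M`, after which the tail tends to `0` with `t`. -/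
lemma tendsto_zero_of_le_kernelTail (hb : (n : ℝ) / 2 < b) {X : ℝ → ℝ≥0∞} {C : ℝ≥0∞}
    (hC : C ≠ ∞)
    (h : ∀ η : ℝ≥0∞, η ≠ 0 → η ≠ ∞ → ∃ δ : ℝ, 0 < δ ∧ ∃ M : ℝ≥0∞, M ≠ ∞ ∧ ∀ t : ℝ, 0 < t →
      X t ≤ C * (η * ENNReal.ofReal (bracketMass n b) + M * kernelTail n b δ t)) :
    Tendsto X (𝓝[>] 0) (𝓝 0) := by
  rw [ENNReal.tendsto_nhds_zero]
  intro ε hε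
  have hlim : Tendsto (fun η : ℝ≥0∞ => C * (η * ENNReal.ofReal (bracketMass n b))) (𝓝 0)
      (𝓝 0) := by
    have h1 := ENNReal.Tendsto.const_mul (a := C) (ENNReal.Tendsto.mul_const
      (b := ENNReal.ofReal (bracketMass n b)) tendsto_id (Or.inr ENNReal.ofReal_ne_top))
      (Or.inr hC) (f := 𝓝 (0 : ℝ≥0∞))
    simpa using h1
  obtain ⟨η, hη0, hη⟩ : ∃ η : ℝ≥0∞, 0 < η ∧
      C * (η * ENNReal.ofReal (bracketMass n b)) < ε ∧ η < ∞ := by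
    have h2 := (hlim.eventually_lt_const hε).and
      (tendsto_id.eventually_lt_const (show (0 : ℝ≥0∞) < ∞ by simp))
    have h3 : ∃ᶠ η : ℝ≥0∞ in 𝓝 0, 0 < η := by
      have : (𝓝[>] (0 : ℝ≥0∞)).NeBot := inferInstance
      exact (eventually_mem_nhdsWithin (s := Ioi (0 : ℝ≥0∞))).frequently.filter_mono
        nhdsWithin_le_nhds
    obtain ⟨η, h4, h5⟩ := (h3.and_eventually h2).exists
    exact ⟨η, h4, h5.1, h5.2⟩
  obtain ⟨δ, hδ, M, hM, hX⟩ := h η hη0.ne' hη.2.ne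
  have h6 : Tendsto (fun t => C * (η * ENNReal.ofReal (bracketMass n b) +
      M * kernelTail n b δ t)) (𝓝[>] 0) (𝓝 (C * (η * ENNReal.ofReal (bracketMass n b)))) := by
    have h7 := ENNReal.Tendsto.const_mul (a := C) ((ENNReal.Tendsto.const_mul (a := M)
      (tendsto_kernelTail (n := n) hb hδ) (Or.inr hM)).const_add
        (η * ENNReal.ofReal (bracketMass n b))) (Or.inr hC)
    simpa using h7
  filter_upwards [h6.eventually_lt_const hη.1, self_mem_nhdsWithin] with t h8 ht
  exact (hX t ht).trans h8.le

end ApproximateIdentity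

/-! ### Convergence almost everywhere, in sup-norm and in `L^p` -/

section Convergence

variable {n : ℕ} {b : ℝ} {𝕜 : Type*} [RCLike 𝕜] {p : ℝ≥0∞} {f : EuclideanSpace ℝ (Fin n) → 𝕜}

lemma integrable_bracketKernel_smul (hb : (n : ℝ) / 2 < b) (hp : 1 ≤ p) (hpt : p ≠ ∞)
    (hf : MemLp f p volume) {t : ℝ} (ht : 0 < t) (x : EuclideanSpace ℝ (Fin n)) :
    Integrable (fun z => bracketKernel b t (x - z) • f z) := by
  have hb0 : 0 < b := lt_of_le_of_lt (by positivity) hb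
  have h := integrable_bracket_smul hb0.le hp hpt (fun h1 => by
    nlinarith [(Real.HolderConjugate.conjExponent h1).symm.lt]) hf x
  have hm : Measurable fun z : EuclideanSpace ℝ (Fin n) => bracketKernel b t (x - z) :=
    (measurable_bracketKernel t).comp (measurable_const.sub measurable_id)
  refine (h.norm.const_mul (t ^ (2 * b - n) * min 1 (t ^ 2) ^ (-b))).mono'
    (hm.aestronglyMeasurable.smul hf.1) (ae_of_all _ fun z => ?_)
  rw [norm_smul, norm_smul, Real.norm_of_nonneg (bracketKernel_nonneg ht _),
    Real.norm_of_nonneg (by positivity), bracketKernel]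
  have h1 := add_rpow_neg_le (by positivity : 0 < t ^ 2) (sq_nonneg ‖x - z‖) hb0.le
  have h2 : 0 ≤ t ^ (2 * b - n) := by positivity
  exact (mul_le_mul_of_nonneg_right (mul_le_mul_of_nonneg_left h1 h2)
    (norm_nonneg (f z))).trans_eq (by ring)

lemma enorm_bracketMean_sub_le (hb : (n : ℝ) / 2 < b) (hp : 1 ≤ p) (hpt : p ≠ ∞)
    (hf : MemLp f p volume) {t : ℝ} (ht : 0 < t) (x : EuclideanSpace ℝ (Fin n)) :
    ‖bracketMean b f t x - bracketMass n b • f x‖ₑ ≤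
      ∫⁻ z, ENNReal.ofReal (bracketKernel b t (x - z)) * ‖f z - f x‖ₑ := by
  have h : bracketMean b f t x - bracketMass n b • f x =
      ∫ z, bracketKernel b t (x - z) • (f z - f x) := by
    simp only [smul_sub]
    rw [integral_sub (integrable_bracketKernel_smul hb hp hpt hf ht x)
      ((integrable_bracketKernel_sub hb ht x).smul_const _), integral_smul_const,
      integral_bracketKernel_sub hb ht, bracketMean]
  rw [h]
  refine (enorm_integral_le_lintegral_enorm _).trans_eq (lintegral_congr fun z => ?_)
  rw [enorm_smul, Real.enorm_of_nonneg (bracketKernel_nonneg ht _)]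

lemma aestronglyMeasurable_bracketMean (hf : AEStronglyMeasurable f volume) (t : ℝ) :
    AEStronglyMeasurable (bracketMean b f t) volume := by
  have hm : Measurable fun z : EuclideanSpace ℝ (Fin n) × EuclideanSpace ℝ (Fin n) =>
      bracketKernel b t (z.1 - z.2) :=
    (measurable_bracketKernel t).comp (measurable_fst.sub measurable_snd)
  exact (hm.aestronglyMeasurable.smul hf.comp_snd).integral_prod_right'

lemma volume_closedBall_eq_ball (x : EuclideanSpace ℝ (Fin n)) {r : ℝ} (hr : 0 < r) :
    volume (Metric.closedBall x r) = volume (Metric.ball x r) := by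
  rw [Measure.addHaar_closedBall _ _ hr.le, Measure.addHaar_ball_of_pos _ _ hr]

/-- The bound `|f| ≤ 1 + |f|^p` replaces Hölder, and for `ρ > δ` the global integral of `|f|^p` is
absorbed by the volume of the ball of radius `δ`. -/
lemma setLIntegral_enorm_sub_le_of_memLp (hp : 1 ≤ p) (hpt : p ≠ ∞) {δ ρ : ℝ}
    (hδ : 0 < δ) (hρ : δ < ρ) (x : EuclideanSpace ℝ (Fin n)) :
    ∫⁻ z in Metric.ball x ρ, ‖f z - f x‖ₑ ≤
      (1 + ‖f x‖ₑ + (∫⁻ z, ‖f z‖ₑ ^ p.toReal) / volume (Metric.ball x δ)) *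
        volume (Metric.ball x ρ) := by
  have hp1 : 1 ≤ p.toReal := by
    rw [← ENNReal.toReal_one]; exact ENNReal.toReal_mono hpt hp
  have h1 : ∀ z, ‖f z - f x‖ₑ ≤ (1 + ‖f x‖ₑ) + ‖f z‖ₑ ^ p.toReal := by
    intro z
    have h2 : ‖f z‖ₑ ≤ 1 + ‖f z‖ₑ ^ p.toReal := by
      rcases le_total ‖f z‖ₑ 1 with h | h
      · exact le_add_right h
      · refine le_add_left ?_
        calc ‖f z‖ₑ = ‖f z‖ₑ ^ (1 : ℝ) := (ENNReal.rpow_one _).symm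
          _ ≤ _ := ENNReal.rpow_le_rpow_of_exponent_le h hp1
    calc _ ≤ ‖f z‖ₑ + ‖f x‖ₑ := enorm_sub_le
      _ ≤ (1 + ‖f z‖ₑ ^ p.toReal) + ‖f x‖ₑ := by gcongr
      _ = _ := by ring
  have hvol : volume (Metric.ball x δ) ≠ 0 := (Metric.measure_ball_pos _ _ hδ).ne'
  calc _ ≤ ∫⁻ z in Metric.ball x ρ, ((1 + ‖f x‖ₑ) + ‖f z‖ₑ ^ p.toReal) :=
        lintegral_mono fun z => h1 z
    _ = (1 + ‖f x‖ₑ) * volume (Metric.ball x ρ) +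
        ∫⁻ z in Metric.ball x ρ, ‖f z‖ₑ ^ p.toReal := by
        rw [lintegral_add_left measurable_const, setLIntegral_const]
    _ ≤ (1 + ‖f x‖ₑ) * volume (Metric.ball x ρ) +
        (∫⁻ z, ‖f z‖ₑ ^ p.toReal) / volume (Metric.ball x δ) * volume (Metric.ball x δ) := by
        rw [ENNReal.div_mul_cancel hvol measure_ball_lt_top.ne]
        gcongr
        exact Measure.restrict_le_self
    _ ≤ (1 + ‖f x‖ₑ) * volume (Metric.ball x ρ) +
        (∫⁻ z, ‖f z‖ₑ ^ p.toReal) / volume (Metric.ball x δ) * volume (Metric.ball x ρ) := by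
        gcongr
    _ = _ := (add_mul _ _ _).symm

/-- At a Lebesgue point the averages of `|f - f(x)|` over small balls are below any given `η`. -/
lemma ae_tendsto_bracketMean (hn : n ≠ 0) (hb : (n : ℝ) / 2 < b) (hp : 1 ≤ p) (hpt : p ≠ ∞)
    (hf : MemLp f p volume) :
    ∀ᵐ x, Tendsto (fun t => bracketMean b f t x) (𝓝[>] 0) (𝓝 (bracketMass n b • f x)) := by
  filter_upwards [(Besicovitch.vitaliFamily (volume : Measure (EuclideanSpace ℝ (Fin n)))
    ).ae_tendsto_lintegral_enorm_sub_div (hf.locallyIntegrable hp)] with x hx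
  have hx := hx.comp (Besicovitch.tendsto_filterAt volume x)
  rw [tendsto_iff_edist_tendsto_0]
  refine tendsto_zero_of_le_kernelTail (n := n) hb ENNReal.one_ne_top fun η hη _ => ?_
  obtain ⟨δ, hδ, hδη⟩ := mem_nhdsGT_iff_exists_Ioc_subset.1
    ((ENNReal.tendsto_nhds_zero.1 hx) η (pos_iff_ne_zero.2 hη))
  have hδ : 0 < δ := hδ
  have hvol : volume (Metric.ball x δ) ≠ 0 := (Metric.measure_ball_pos _ _ hδ).ne'
  have hfin := lintegral_rpow_enorm_lt_top_of_eLpNorm_lt_top (one_pos.trans_le hp).ne' hpt hf.2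
  refine ⟨δ, hδ, 1 + ‖f x‖ₑ + (∫⁻ z, ‖f z‖ₑ ^ p.toReal) / volume (Metric.ball x δ),
    by simp [ENNReal.div_eq_top, hvol, hfin.ne], fun t ht => ?_⟩
  rw [one_mul, edist_eq_enorm_sub]
  refine (enorm_bracketMean_sub_le hb hp hpt hf ht x).trans
    (lintegral_bracketKernel_mul_le hn hb ht hδ x (hf.1.sub aestronglyMeasurable_const).enorm
      (by simp [ENNReal.div_eq_top, hvol, hfin.ne]) (fun ρ h0 h1 => ?_)
      fun ρ h1 => setLIntegral_enorm_sub_le_of_memLp hp hpt hδ h1 x)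
  have h2 : (∫⁻ y in Metric.closedBall x ρ, ‖f y - f x‖ₑ) / volume (Metric.closedBall x ρ) ≤ η :=
    hδη ⟨h0, h1⟩
  rw [volume_closedBall_eq_ball x h0, ENNReal.div_le_iff (Metric.measure_ball_pos _ _ h0).ne'
    measure_ball_lt_top.ne] at h2
  exact (lintegral_mono_set Metric.ball_subset_closedBall).trans h2

lemma tendstoUniformly_bracketMean (hn : n ≠ 0) (hb : (n : ℝ) / 2 < b) (hp : 1 ≤ p)
    (hpt : p ≠ ∞) (hf : MemLp f p volume) (hc : Continuous f)
    (h0 : Tendsto f (cocompact (EuclideanSpace ℝ (Fin n))) (𝓝 0)) :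
    Tendsto (fun t => ⨆ x, ‖bracketMean b f t x - bracketMass n b • f x‖ₑ) (𝓝[>] 0) (𝓝 0) := by
  have huc : UniformContinuous f := hc.uniformContinuous_of_tendsto_cocompact h0
  let F : ZeroAtInftyContinuousMap (EuclideanSpace ℝ (Fin n)) 𝕜 := ⟨⟨f, hc⟩, h0⟩
  have hF : ∀ x, ‖f x‖ₑ ≤ ENNReal.ofReal ‖F.toBCF‖ := fun x => by
    rw [← ofReal_norm]
    exact ENNReal.ofReal_le_ofReal (F.toBCF.norm_coe_le_norm x)
  refine tendsto_zero_of_le_kernelTail (n := n) hb ENNReal.one_ne_top fun η hη hη' => ?_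
  obtain ⟨δ, hδ, hδη⟩ := Metric.uniformContinuous_iff.1 huc η.toReal (ENNReal.toReal_pos hη hη')
  refine ⟨δ, hδ, 2 * ENNReal.ofReal ‖F.toBCF‖, by finiteness, fun t ht => ?_⟩
  rw [one_mul]
  refine iSup_le fun x => (enorm_bracketMean_sub_le hb hp hpt hf ht x).trans
    (lintegral_bracketKernel_mul_le hn hb ht hδ x (hf.1.sub aestronglyMeasurable_const).enorm
      (by finiteness) (fun ρ _ h1 => ?_) fun ρ _ => ?_)
  · rw [← setLIntegral_const]
    refine setLIntegral_mono' Metric.isOpen_ball.measurableSet fun z hz => ?_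
    have h2 := hδη (a := z) (b := x) (lt_of_lt_of_le hz h1)
    rw [dist_eq_norm] at h2
    rw [← ofReal_norm]
    exact ENNReal.ofReal_le_of_le_toReal h2.le
  · rw [← setLIntegral_const]
    refine lintegral_mono fun z => ?_
    rw [two_mul]
    exact enorm_sub_le.trans (add_le_add (hF z) (hF x))

lemma tendsto_eLpNorm_translate_sub (hp : 1 ≤ p) (hpt : p ≠ ∞) (hf : MemLp f p volume) :
    Tendsto (fun w => eLpNorm (fun x => f (x - w) - f x) p volume) (𝓝 0) (𝓝 0) := by
  have : Fact (1 ≤ p) := ⟨hp⟩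
  have : Fact (p ≠ ∞) := ⟨hpt⟩
  -- Translations act continuously on `L^p` for finite `p`; the sign makes the action `x ↦ f(x -
  -- w)`.
  have hcont : Continuous fun w : EuclideanSpace ℝ (Fin n) =>
      DomAddAct.mk (-w) +ᵥ hf.toLp f :=
    (DomAddAct.continuous_mk.comp continuous_neg).vadd continuous_const
  have h := tendsto_iff_edist_tendsto_0.1 (hcont.tendsto 0)
  simp only [DomAddAct.mk_vadd_toLp, Lp.edist_toLp_toLp] at h
  refine h.congr fun w => congrArg (fun g => eLpNorm g p volume) ?_
  ext x
  simp [sub_eq_neg_add]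

/-- Jensen's inequality in unnormalized form: compare the `L^1` and `L^P` norms for the measure with
density `k`. -/
lemma lintegral_mul_rpow_le {k : EuclideanSpace ℝ (Fin n) → ℝ≥0∞} (hk : Measurable k)
    {G : EuclideanSpace ℝ (Fin n) → 𝕜} (hG : StronglyMeasurable G) {P : ℝ} (hP : 1 ≤ P) :
    (∫⁻ w, k w * ‖G w‖ₑ) ^ P ≤ (∫⁻ w, k w) ^ (P - 1) * ∫⁻ w, k w * ‖G w‖ₑ ^ P := by
  have hP0 : 0 < P := one_pos.trans_le hP
  have h := eLpNorm'_le_eLpNorm'_mul_rpow_measure_univ (μ := volume.withDensity k) one_pos hP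
    hG.aestronglyMeasurable
  simp only [eLpNorm', ENNReal.rpow_one, div_one, withDensity_apply k MeasurableSet.univ,
    Measure.restrict_univ] at h
  rw [lintegral_withDensity_eq_lintegral_mul _ hk hG.enorm,
    lintegral_withDensity_eq_lintegral_mul _ hk (hG.enorm.pow_const P)] at h
  refine (ENNReal.rpow_le_rpow h hP0.le).trans_eq ?_
  rw [ENNReal.mul_rpow_of_nonneg _ _ hP0.le, ← ENNReal.rpow_mul, ← ENNReal.rpow_mul,
    one_div_mul_cancel hP0.ne', ENNReal.rpow_one, mul_comm]
  congr 2
  field_simp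

/-- The `p`-th power of the `L^p` distance between `f` and its translate by `w`. -/
def translateDefect (P : ℝ) (f : EuclideanSpace ℝ (Fin n) → 𝕜) (w : EuclideanSpace ℝ (Fin n)) :
    ℝ≥0∞ :=
  ∫⁻ x, ‖f (x - w) - f x‖ₑ ^ P

lemma stronglyMeasurable_translate_sub (hf : StronglyMeasurable f) :
    StronglyMeasurable fun z : EuclideanSpace ℝ (Fin n) × EuclideanSpace ℝ (Fin n) =>
      f (z.1 - z.2) - f z.1 :=
  (hf.comp_measurable (measurable_fst.sub measurable_snd)).sub (hf.comp_measurable measurable_fst)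

lemma measurable_translateDefect (hf : StronglyMeasurable f) (P : ℝ) :
    Measurable (translateDefect P f) :=
  ((stronglyMeasurable_translate_sub hf).enorm.pow_const P).lintegral_prod_left'

/-- Jensen followed by Tonelli plays the part of Minkowski's integral inequality. The outcome is
again an integral against the kernel, centred at `0`, so the ball estimate applies to it. -/
lemma lintegral_enorm_bracketMean_sub_rpow_le (hb : (n : ℝ) / 2 < b) (hp : 1 ≤ p)
    (hpt : p ≠ ∞) (hf : MemLp f p volume) (hfm : StronglyMeasurable f) {t : ℝ} (ht : 0 < t) :
    ∫⁻ x, ‖bracketMean b f t x - bracketMass n b • f x‖ₑ ^ p.toReal ≤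
      ENNReal.ofReal (bracketMass n b) ^ (p.toReal - 1) *
        ∫⁻ w, ENNReal.ofReal (bracketKernel b t (0 - w)) * translateDefect p.toReal f w := by
  have hp1 : 1 ≤ p.toReal := by
    rw [← ENNReal.toReal_one]; exact ENNReal.toReal_mono hpt hp
  have hk : Measurable fun w : EuclideanSpace ℝ (Fin n) =>
    ENNReal.ofReal (bracketKernel b t w) := (measurable_bracketKernel t).ennreal_ofReal
  have hsm := stronglyMeasurable_translate_sub hfm
  have hsymm : ∀ w : EuclideanSpace ℝ (Fin n), bracketKernel b t (0 - w) = bracketKernel b t w :=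
    fun w => by simp [bracketKernel]
  simp only [hsymm]
  calc _ ≤ ∫⁻ x, (∫⁻ w, ENNReal.ofReal (bracketKernel b t w) * ‖f (x - w) - f x‖ₑ) ^
        p.toReal := by
        refine lintegral_mono fun x => ENNReal.rpow_le_rpow ?_ (by linarith)
        refine (enorm_bracketMean_sub_le hb hp hpt hf ht x).trans_eq ?_
        rw [← lintegral_sub_left_eq_self (fun z => ENNReal.ofReal (bracketKernel b t (x - z)) *
          ‖f z - f x‖ₑ) x]
        simp only [sub_sub_cancel]
    _ ≤ ∫⁻ x, ENNReal.ofReal (bracketMass n b) ^ (p.toReal - 1) *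
        ∫⁻ w, ENNReal.ofReal (bracketKernel b t w) * ‖f (x - w) - f x‖ₑ ^ p.toReal := by
        refine lintegral_mono fun x => ?_
        rw [← lintegral_bracketKernel hb ht]
        exact lintegral_mul_rpow_le hk (hsm.comp_measurable measurable_prodMk_left) hp1
    _ = _ := by
        rw [lintegral_const_mul' _ _ (ENNReal.rpow_ne_top_of_nonneg (by linarith)
          ENNReal.ofReal_ne_top), lintegral_lintegral_swap]
        · congr 1
          refine lintegral_congr fun w => ?_
          rw [lintegral_const_mul' _ _ ENNReal.ofReal_ne_top, translateDefect]
        · exact ((hk.comp measurable_snd).mul (hsm.enorm.pow_const _)).aemeasurable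

lemma translateDefect_eq (hp : 1 ≤ p) (hpt : p ≠ ∞) (w : EuclideanSpace ℝ (Fin n)) :
    translateDefect p.toReal f w =
      eLpNorm (fun x => f (x - w) - f x) p volume ^ p.toReal := by
  have hp0 : p ≠ 0 := (one_pos.trans_le hp).ne'
  rw [eLpNorm_eq_lintegral_rpow_enorm_toReal hp0 hpt, ← ENNReal.rpow_mul,
    one_div_mul_cancel (ENNReal.toReal_pos hp0 hpt).ne', ENNReal.rpow_one, translateDefect]

lemma translateDefect_le (hp : 1 ≤ p) (hpt : p ≠ ∞) (hf : MemLp f p volume)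
    (w : EuclideanSpace ℝ (Fin n)) :
    translateDefect p.toReal f w ≤ (2 * eLpNorm f p volume) ^ p.toReal := by
  rw [translateDefect_eq hp hpt]
  refine ENNReal.rpow_le_rpow ?_ ENNReal.toReal_nonneg
  have hmp := measurePreserving_sub_right (volume : Measure (EuclideanSpace ℝ (Fin n))) w
  have h1 : eLpNorm (fun x => f (x - w)) p volume = eLpNorm f p volume :=
    eLpNorm_comp_measurePreserving hf.1 hmp
  refine (eLpNorm_sub_le (hf.comp_measurePreserving hmp).1 hf.1 hp).trans_eq ?_
  rw [two_mul]
  congr 1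

lemma exists_lintegral_enorm_bracketMean_sub_le (hn : n ≠ 0) (hb : (n : ℝ) / 2 < b)
    (hp : 1 ≤ p) (hpt : p ≠ ∞) (hf : MemLp f p volume) (hfm : StronglyMeasurable f) {η : ℝ≥0∞}
    (hη : η ≠ 0) : ∃ δ : ℝ, 0 < δ ∧ ∃ M : ℝ≥0∞, M ≠ ∞ ∧ ∀ t : ℝ, 0 < t →
      ∫⁻ x, ‖bracketMean b f t x - bracketMass n b • f x‖ₑ ^ p.toReal ≤
        ENNReal.ofReal (bracketMass n b) ^ (p.toReal - 1) *
          (η * ENNReal.ofReal (bracketMass n b) + M * kernelTail n b δ t) := by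
  have hP : 0 < p.toReal := ENNReal.toReal_pos (one_pos.trans_le hp).ne' hpt
  have hlim : Tendsto (translateDefect p.toReal f) (𝓝 0) (𝓝 0) := by
    have h := (tendsto_eLpNorm_translate_sub hp hpt hf).ennrpow_const p.toReal
    rw [ENNReal.zero_rpow_of_pos hP] at h
    exact h.congr fun w => (translateDefect_eq hp hpt w).symm
  obtain ⟨δ, hδ, hδη⟩ := Metric.eventually_nhds_iff_ball.1
    (ENNReal.tendsto_nhds_zero.1 hlim η (pos_iff_ne_zero.2 hη))
  have hM : (2 * eLpNorm f p volume) ^ p.toReal ≠ ∞ :=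
    ENNReal.rpow_ne_top_of_nonneg hP.le (ENNReal.mul_ne_top ENNReal.ofNat_ne_top hf.2.ne)
  refine ⟨δ, hδ, _, hM, fun t ht =>
    (lintegral_enorm_bracketMean_sub_rpow_le hb hp hpt hf hfm ht).trans ?_⟩
  gcongr
  refine lintegral_bracketKernel_mul_le hn hb ht hδ 0
    (measurable_translateDefect hfm _).aemeasurable hM (fun ρ _ h1 => ?_) fun ρ _ => ?_
  · rw [← setLIntegral_const]
    exact setLIntegral_mono' Metric.isOpen_ball.measurableSet fun w hw =>
      hδη w (Metric.ball_subset_ball h1 hw)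
  · rw [← setLIntegral_const]
    exact lintegral_mono fun w => translateDefect_le hp hpt hf w

lemma bracketMean_congr_ae {g : EuclideanSpace ℝ (Fin n) → 𝕜} (h : f =ᵐ[volume] g) (t : ℝ) :
    bracketMean b f t = bracketMean b g t := by
  ext x
  refine integral_congr_ae ?_
  filter_upwards [h] with z hz
  rw [hz]

lemma eLpNorm_bracketMean_sub (hn : n ≠ 0) (hb : (n : ℝ) / 2 < b) (hp : 1 ≤ p) (hpt : p ≠ ∞)
    (hf : MemLp f p volume) :
    (∀ t : ℝ, 0 < t → eLpNorm (bracketMean b f t - bracketMass n b • f) p volume ≠ ∞) ∧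
      Tendsto (fun t => eLpNorm (bracketMean b f t - bracketMass n b • f) p volume)
        (𝓝[>] 0) (𝓝 0) := by
  have hp0 : p ≠ 0 := (one_pos.trans_le hp).ne'
  have hp1 : 1 ≤ p.toReal := by
    rw [← ENNReal.toReal_one]; exact ENNReal.toReal_mono hpt hp
  have hP : 0 < p.toReal := one_pos.trans_le hp1
  -- A strongly measurable representative makes `f(x - w) - f(x)` jointly measurable; the means do
  -- not see the change.
  obtain ⟨g, hg, hfg⟩ := hf.1
  have hg' : MemLp g p volume := (memLp_congr_ae hfg).1 hf
  have e : ∀ t, eLpNorm (bracketMean b f t - bracketMass n b • f) p volume =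
      (∫⁻ x, ‖bracketMean b g t x - bracketMass n b • g x‖ₑ ^ p.toReal) ^ (1 / p.toReal) := by
    intro t
    rw [← eLpNorm_eq_lintegral_rpow_enorm_toReal hp0 hpt, bracketMean_congr_ae hfg]
    refine eLpNorm_congr_ae ?_
    filter_upwards [hfg] with x hx
    simp [hx]
  have hC : ENNReal.ofReal (bracketMass n b) ^ (p.toReal - 1) ≠ ∞ :=
    ENNReal.rpow_ne_top_of_nonneg (by linarith) ENNReal.ofReal_ne_top
  simp only [e]
  constructor
  · intro t ht
    refine ENNReal.rpow_ne_top_of_nonneg (by positivity) ?_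
    obtain ⟨δ, hδ, M, hM, h⟩ := exists_lintegral_enorm_bracketMean_sub_le hn hb hp hpt hg' hg
      one_ne_zero
    exact ne_top_of_le_ne_top (ENNReal.mul_ne_top hC (ENNReal.add_ne_top.2
      ⟨ENNReal.mul_ne_top ENNReal.one_ne_top ENNReal.ofReal_ne_top,
        ENNReal.mul_ne_top hM (kernelTail_ne_top hb hδ t)⟩)) (h t ht)
  · have h := tendsto_zero_of_le_kernelTail (n := n) hb hC fun η hη _ =>
      exists_lintegral_enorm_bracketMean_sub_le hn hb hp hpt hg' hg hη
    have h2 := h.ennrpow_const (1 / p.toReal)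
    rwa [ENNReal.zero_rpow_of_pos (by positivity)] at h2

theorem convergesTo_of_eq_smul_bracketMean (hn : n ≠ 0) (hb : (n : ℝ) / 2 < b) (hp : 1 ≤ p)
    (hpt : p ≠ ∞) (hf : MemLp f p volume) (c : ℝ) {F : ℝ → EuclideanSpace ℝ (Fin n) → 𝕜}
    (hF : ∀ t : ℝ, 0 < t → ∀ x, F t x = c • bracketMean b f t x) :
    ConvergesTo p f F ((c * bracketMass n b) • f) := by
  obtain ⟨hfin, hlim⟩ := eLpNorm_bracketMean_sub hn hb hp hpt hf
  have hF' : ∀ t : ℝ, 0 < t → F t = c • bracketMean b f t := fun t ht => funext (hF t ht)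
  have hpos : ∀ᶠ t : ℝ in 𝓝[>] 0, 0 < t := self_mem_nhdsWithin
  have hmem : MemLp (bracketMass n b • f) p volume := hf.const_smul _
  refine ⟨fun t ht => ?_, ?_, ?_, fun hc h0 => ?_⟩
  · have h1 : MemLp (bracketMean b f t - bracketMass n b • f) p volume :=
      ⟨(aestronglyMeasurable_bracketMean hf.1 t).sub hmem.1, (hfin t ht).lt_top⟩
    rw [hF' t ht]
    have h2 := (h1.add hmem).const_smul c
    rwa [sub_add_cancel] at h2
  · have h1 := ENNReal.Tendsto.const_mul (a := ‖c‖ₑ) hlim (Or.inr enorm_ne_top)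
    rw [mul_zero] at h1
    refine h1.congr' ?_
    filter_upwards [hpos] with t ht
    rw [hF' t ht, mul_smul, ← smul_sub, eLpNorm_const_smul]
  · filter_upwards [ae_tendsto_bracketMean hn hb hp hpt hf] with x hx
    have h1 := hx.const_smul c
    rw [smul_smul] at h1
    refine h1.congr' ?_
    filter_upwards [hpos] with t ht
    rw [hF t ht]
  · have h1 := ENNReal.Tendsto.const_mul (a := ‖c‖ₑ)
      (tendstoUniformly_bracketMean hn hb hp hpt hf hc h0) (Or.inr enorm_ne_top)
    rw [mul_zero] at h1
    refine EMetric.tendstoUniformly_iff.2 fun ε hε => ?_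
    filter_upwards [h1.eventually_lt_const hε, hpos] with t h2 ht x
    refine lt_of_le_of_lt ?_ h2
    rw [edist_comm, edist_eq_enorm_sub, hF t ht, Pi.smul_apply, mul_smul, ← smul_sub, enorm_smul]
    gcongr
    exact le_iSup (fun x => ‖bracketMean b f t x - bracketMass n b • f x‖ₑ) x

end Convergence

end RieszInversion

end

theorem theoremA {𝕜 : Type*} [RCLike 𝕜] (n m : ℕ) (α : ℝ) (p : ℝ≥0∞)
    (hα : 0 < α) (hαn : α < n) (hm : α < 2 * m)
    (hp : 1 ≤ p) (hpα : p < ENNReal.ofReal (n / α))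
    (f : EuclideanSpace ℝ (Fin n) → 𝕜) (hf : MemLp f p volume) :
    -- the integrals involved converge absolutely
    (∀ᵐ x, Integrable (RieszInversion.rieszIntegrand α f x) volume) ∧
    (∀ t : ℝ, 0 < t →
      RieszInversion.ConvDefined (RieszInversion.rieszPotential α f)
        (fun y => t ^ (-α) * RieszInversion.dilate (RieszInversion.recon n m α) t y) ∧
      RieszInversion.ConvDefined (RieszInversion.rieszPotential α f)
        (RieszInversion.dilate (RieszInversion.reconTilde n m α) t)) ∧
    (∀ ε : ℝ, 0 < ε → ∀ x,
      IntegrableOn (RieszInversion.waveletIntegrand m α f x) (Ioi ε) volume) ∧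
    -- the approximate inversion formula
    RieszInversion.ConvergesTo p f (RieszInversion.approxInv m α f)
      (RieszInversion.rieszGamma n (2 * m - α) • f) ∧
    -- the wavelet-type inversion formula
    RieszInversion.ConvergesTo p f (RieszInversion.waveletInv m α f)
      (((2 * m - α) * RieszInversion.rieszGamma n (2 * m - α)) • f) := by
  have hn0 : (0 : ℝ) < n := hα.trans hαn
  have hn : n ≠ 0 := by rintro rfl; simp at hn0
  have hpt : p ≠ ∞ := (hpα.trans ENNReal.ofReal_lt_top).ne
  refine ⟨RieszInversion.ae_integrable_rieszIntegrand hα hαn hp hpα hf,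
    fun t ht => ⟨RieszInversion.convDefined_recon hα hαn hp hpα hf m ht,
      RieszInversion.convDefined_reconTilde hα hαn hp hpα hf m ht⟩,
    fun ε hε x => RieszInversion.integrableOn_waveletIntegrand hα hαn hp hpα hf m hε x, ?_, ?_⟩
  · rw [← RieszInversion.approx_const_eq hα hαn]
    -- The side condition `n/2 < (n-α)/2 + m` is `α < 2m`.
    exact RieszInversion.convergesTo_of_eq_smul_bracketMean hn (by linarith) hp hpt hf _
      fun t ht x => RieszInversion.approxInv_eq hα hαn hp hpα hf m ht x
  · rw [← RieszInversion.wavelet_const_eq hα hαn hm]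
    exact RieszInversion.convergesTo_of_eq_smul_bracketMean hn (by push_cast; linarith) hp hpt hf _
      fun ε hε x => RieszInversion.waveletInv_eq hα hαn hp hpα hf m hε x
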